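/- All graphs are finite and simple, and "$H$-free" means having no induced subgraph isomorphic to $H$. Let $S_2$ be the graph obtained from the claw $K_{1,3}$ by replacing each edge with a path with two edges, and let $T_2$ be the graph obtained from a triangle by appending a path with two edges to each of its three vertices. The eccentricity of a path $P$ in a connected graph $G$ is the maximum distance from a vertex of $G$ to (a nearest vertex of) $P$, and the path eccentricity $\mathrm{pe}(G)$ is the minimum eccentricity of a path in $G$. A path $P$ is dominating if every vertex not on $P$ has a neighbor on $P$. Every connected graph $G$ that is both $S_2$-free and $T_2$-free has a dominating path; that is, $\mathrm{pe}(G)\le 1$. This applies in particular to connected graphs of each of the following classes, since every graph (connected or not) in one of these classes is both $S_2$-free and $T_2$-free: (i) $P_5$-free graphs, where $P_5$ is the path on five vertices; (ii) AT-free graphs, i.e. graphs with no independent set $I$ of three vertices such that for every $v\in I$ the other two vertices of $I$ lie in the same component of $G-N[v]$, where $N[v]$ consists of $v$ and its neighbors; (iii) biconvex graphs, i.e. bipartite graphs with parts $A$ and $B$ that can each be linearly ordered so that for every vertex $v$ the neighborhood of $v$ is a set of consecutive vertices in the ordering of the part not containing $v$. -/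

import Mathlib

namespace PathEcc

/-- The `k`-subdivided claw `S_k`: a centre `none` and three pairwise disjoint legs
`(i, 0), …, (i, k - 1)`, whose first vertex is joined to the centre; each edge of the claw has
become a path with `k` edges. -/
def subdividedClaw (k : ℕ) : SimpleGraph (Option (Fin 3 × Fin k)) :=
  SimpleGraph.fromRel fun x y =>
    match x, y with
    | none, some (_, j) => (j : ℕ) = 0
    | some (i, j), some (i', j') => i = i' ∧ (j : ℕ) + 1 = j'
    | _, none => False

/-- The `k`-subdivided net `T_k`: the triangle `(0, 0), (1, 0), (2, 0)`, with a path
`(i, 0), (i, 1), …, (i, k)` with `k` edges appended to each of its vertices `(i, 0)`. -/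
def subdividedNet (k : ℕ) : SimpleGraph (Fin 3 × Fin (k + 1)) :=
  SimpleGraph.fromRel fun x y =>
    ((x.2 : ℕ) = 0 ∧ (y.2 : ℕ) = 0) ∨ (x.1 = y.1 ∧ (x.2 : ℕ) + 1 = y.2)

/-- `G` is `H`-free: no induced subgraph of `G` is isomorphic to `H`. -/
def InducedFree {V W : Type*} (H : SimpleGraph W) (G : SimpleGraph V) : Prop :=
  ¬ H.IsIndContained G

/-- `G` has a dominating path: every vertex not on the path has a neighbour on the path. -/
def HasDominatingPath {V : Type*} (G : SimpleGraph V) : Prop :=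
  ∃ (u v : V) (p : G.Walk u v), p.IsPath ∧
    ∀ w : V, w ∉ p.support → ∃ x ∈ p.support, G.Adj w x

/-- The eccentricity of a walk `p` in `G`: the largest distance from a vertex of `G` to `p`, that
is, to the nearest vertex of `p`. -/
noncomputable def walkEccentricity {V : Type*} (G : SimpleGraph V) {u v : V} (p : G.Walk u v) :
    ℕ∞ :=
  ⨆ w : V, ⨅ x ∈ p.support, G.edist w x

/-- The path eccentricity of `G`: the smallest eccentricity of a path in `G`. -/
noncomputable def pathEccentricity {V : Type*} (G : SimpleGraph V) : ℕ∞ :=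
  ⨅ (u : V) (v : V) (p : G.Walk u v) (_ : p.IsPath), walkEccentricity G p

/-- The graph `G - N[v]` has vertex set the complement of the closed neighbourhood of `v`. -/
def awayFrom {V : Type*} (G : SimpleGraph V) (v : V) : Set V :=
  (insert v (G.neighborSet v))ᶜ

/-- `G` is AT-free: it has no independent set `I` with three vertices such that, for every
`v ∈ I`, the remaining two vertices of `I` are in the same component of `G - N[v]`. -/
def ATFree {V : Type*} (G : SimpleGraph V) : Prop :=
  ¬ ∃ I : Finset V, I.card = 3 ∧ G.IsIndepSet (I : Set V) ∧
    ∀ v ∈ I, ∀ x ∈ I, ∀ y ∈ I, x ≠ v → y ≠ v → x ≠ y →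
      ∃ (hx : x ∈ awayFrom G v) (hy : y ∈ awayFrom G v),
        (G.induce (awayFrom G v)).Reachable ⟨x, hx⟩ ⟨y, hy⟩

/-- `G` is biconvex: it is bipartite with parts `A` and `B` that can each be linearly ordered so
that the neighbourhood of each vertex is consecutive in the order of the other part. -/
def Biconvex {V : Type*} (G : SimpleGraph V) : Prop :=
  ∃ A B : Set V, A ∪ B = Set.univ ∧ G.IsBipartiteWith A B ∧
    ∃ (_ : LinearOrder A) (_ : LinearOrder B),
      (∀ b : B, Set.OrdConnected {a : A | G.Adj b a}) ∧
      (∀ a : A, Set.OrdConnected {b : B | G.Adj a b})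

end PathEcc

open PathEcc

/-! ### Recognising induced copies of the subdivided claw and net -/

namespace PathEcc

/-! The engine is a rooted form of the fact that connected claw- and net-free graphs have
Hamiltonian paths (`IsInducedPath.exists_hamiltonian_list`). In a connected set `X`, a longest
induced path `c 0, …, c d` from the root dominates `X`: an edge leaving the dominated set yields a
claw, a net or a longer path. The vertices of `X` away from the root then fall into cliques that can
be inserted between consecutive path vertices, and the neighbourhood of the root, having no
independent triple, is traversed separately. Each claw or net met away from the root has an anchored
leaf, that is, a leaf that is the root or has a further private continuation in `X`; only these must
be excluded.

It remains to find a connected dominating `X` whose anchored claws and nets would extend to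
`subdividedClaw 2` or `subdividedNet 2` in `G`. This is done by induction on the number of vertices.
If every vertex with two neighbours is a cut vertex, `X` consists of these vertices: each leaf of a
claw or net continues into a part of the graph cut off by that leaf, and such continuations are
pairwise nonadjacent.

Otherwise some non-cut vertex `v` has neighbours `u ≠ b`. If a dominating path of `G - v` misses the
neighbours of `v`, then deleting all neighbours of `v` except `u` leaves a connected graph, which
has a dominating path by induction. If this path does not dominate some `z`, then adding the tail
`z, v` at `u` gives a connected dominating set (`IsTailed`). Among the sets with this tail, take one
of minimum size and then of maximum distance sum from `z`. Minimality gives private neighbours to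
non-cut vertices outside the tail; the distance sum lets those of two leaves be chosen nonadjacent
(`IsOptimalTailed.exists_not_adj_of_dist_le`). This extends two leaves of a claw or net, and the
anchor extends the third. -/

instance subdividedClaw.decidableAdj (k : ℕ) : DecidableRel (subdividedClaw k).Adj
  | none, none => isFalse (SimpleGraph.irrefl _)
  | none, some (_, j) => decidable_of_iff ((j : ℕ) = 0) (by simp [subdividedClaw])
  | some (_, j), none => decidable_of_iff ((j : ℕ) = 0) (by simp [subdividedClaw])
  | some (i, j), some (i', j') =>
    decidable_of_iff ((i, j) ≠ (i', j') ∧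
      ((i = i' ∧ (j : ℕ) + 1 = j') ∨ (i' = i ∧ (j' : ℕ) + 1 = j))) (by simp [subdividedClaw])

instance subdividedNet.decidableAdj (k : ℕ) : DecidableRel (subdividedNet k).Adj := fun x y =>
  decidable_of_iff (x ≠ y ∧
    ((((x.2 : ℕ) = 0 ∧ (y.2 : ℕ) = 0) ∨ (x.1 = y.1 ∧ (x.2 : ℕ) + 1 = y.2)) ∨
      (((y.2 : ℕ) = 0 ∧ (x.2 : ℕ) = 0) ∨ (y.1 = x.1 ∧ (y.2 : ℕ) + 1 = x.2)))) Iff.rfl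

/-- Distinctness of the seven vertices need not be assumed: no two vertices of the subdivided claw
have the same neighbourhood, so agreement of adjacency forces injectivity. The same holds for the
net below. -/
theorem InducedFree.false_of_subdividedClaw {V : Type*} {G : SimpleGraph V}
    (h : InducedFree (subdividedClaw 2) G) (c : V) (p q : Fin 3 → V)
    (hcp : ∀ i, G.Adj c (p i)) (hpq : ∀ i, G.Adj (p i) (q i)) (hcq : ∀ i, ¬ G.Adj c (q i))
    (hpp : ∀ i j, i ≠ j → ¬ G.Adj (p i) (p j)) (hpq' : ∀ i j, i ≠ j → ¬ G.Adj (p i) (q j))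
    (hqq : ∀ i j, i ≠ j → ¬ G.Adj (q i) (q j)) : False := by
  let f : Option (Fin 3 × Fin 2) → V := fun
    | none => c
    | some (i, 0) => p i
    | some (i, 1) => q i
  have hf : ∀ x y, G.Adj (f x) (f y) ↔ (subdividedClaw 2).Adj x y := by
    have hpq2 : ∀ i j, G.Adj (p i) (q j) ↔ i = j := fun i j =>
      ⟨fun h1 => by_contra fun h2 => hpq' i j h2 h1, fun h1 => h1 ▸ hpq i⟩
    have hqp2 : ∀ i j, G.Adj (q i) (p j) ↔ i = j := fun i j => by
      rw [G.adj_comm, hpq2, eq_comm]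
    have hpp2 : ∀ i j, ¬ G.Adj (p i) (p j) := fun i j h1 =>
      hpp i j (fun h2 => G.loopless.irrefl _ (h2 ▸ h1)) h1
    have hqq2 : ∀ i j, ¬ G.Adj (q i) (q j) := fun i j h1 =>
      hqq i j (fun h2 => G.loopless.irrefl _ (h2 ▸ h1)) h1
    have hpc : ∀ i, G.Adj (p i) c := fun i => (hcp i).symm
    have hqc : ∀ i, ¬ G.Adj (q i) c := fun i h => hcq i h.symm
    rintro (_ | ⟨i, j⟩) (_ | ⟨i', j'⟩)
    · simp
    · fin_cases j' <;> simp [f, subdividedClaw, hcp, hcq]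
    · fin_cases j <;> simp [f, subdividedClaw, hpc, hqc]
    · fin_cases j <;> fin_cases j' <;>
        simp +contextual [f, subdividedClaw, hpq2, hqp2, hpp2, hqq2, eq_comm]
  have hinj : ∀ x y, (∀ z, (subdividedClaw 2).Adj x z ↔ (subdividedClaw 2).Adj y z) → x = y := by
    decide
  exact h ⟨⟨⟨f, fun x y hxy => hinj x y fun z => by rw [← hf, ← hf, hxy]⟩, hf _ _⟩⟩

theorem InducedFree.false_of_subdividedNet {V : Type*} {G : SimpleGraph V}
    (h : InducedFree (subdividedNet 2) G) (a p q : Fin 3 → V)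
    (haa : ∀ i j, i ≠ j → G.Adj (a i) (a j))
    (hap : ∀ i, G.Adj (a i) (p i)) (hpq : ∀ i, G.Adj (p i) (q i))
    (haq : ∀ i j, ¬ G.Adj (a i) (q j)) (hap' : ∀ i j, i ≠ j → ¬ G.Adj (a i) (p j))
    (hpp : ∀ i j, i ≠ j → ¬ G.Adj (p i) (p j)) (hpq' : ∀ i j, i ≠ j → ¬ G.Adj (p i) (q j))
    (hqq : ∀ i j, i ≠ j → ¬ G.Adj (q i) (q j)) : False := by
  let f : Fin 3 × Fin 3 → V := fun
    | (i, 0) => a i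
    | (i, 1) => p i
    | (i, 2) => q i
  have hf : ∀ x y, G.Adj (f x) (f y) ↔ (subdividedNet 2).Adj x y := by
    have hpq2 : ∀ i j, G.Adj (p i) (q j) ↔ i = j := fun i j =>
      ⟨fun h1 => by_contra fun h2 => hpq' i j h2 h1, fun h1 => h1 ▸ hpq i⟩
    have hqp2 : ∀ i j, G.Adj (q i) (p j) ↔ i = j := fun i j => by
      rw [G.adj_comm, hpq2, eq_comm]
    have hap2 : ∀ i j, G.Adj (a i) (p j) ↔ i = j := fun i j =>
      ⟨fun h1 => by_contra fun h2 => hap' i j h2 h1, fun h1 => h1 ▸ hap i⟩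
    have hpa2 : ∀ i j, G.Adj (p i) (a j) ↔ i = j := fun i j => by
      rw [G.adj_comm, hap2, eq_comm]
    have haa2 : ∀ i j, G.Adj (a i) (a j) ↔ i ≠ j := fun i j =>
      ⟨fun h1 h2 => G.loopless.irrefl _ (h2 ▸ h1), haa i j⟩
    have hpp2 : ∀ i j, ¬ G.Adj (p i) (p j) := fun i j h1 =>
      hpp i j (fun h2 => G.loopless.irrefl _ (h2 ▸ h1)) h1
    have hqq2 : ∀ i j, ¬ G.Adj (q i) (q j) := fun i j h1 =>
      hqq i j (fun h2 => G.loopless.irrefl _ (h2 ▸ h1)) h1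
    have hqa : ∀ i j, ¬ G.Adj (q i) (a j) := fun i j h => haq j i h.symm
    rintro ⟨i, j⟩ ⟨i', j'⟩
    fin_cases j <;> fin_cases j' <;>
        simp +contextual [f, subdividedNet, hpq2, hqp2, hpp2, hqq2, hap2, hpa2, haa2, haq, hqa,
          eq_comm]
  have hinj : ∀ x y, (∀ z, (subdividedNet 2).Adj x z ↔ (subdividedNet 2).Adj y z) → x = y := by
    decide
  exact h ⟨⟨⟨f, fun x y hxy => hinj x y fun z => by rw [← hf, ← hf, hxy]⟩, hf _ _⟩⟩

/-! ### The three graph classes -/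

theorem InducedFree.of_isIndContained {V W U : Type*} {H : SimpleGraph W} {K : SimpleGraph U}
    {G : SimpleGraph V} (h : InducedFree H G) (hHK : H.IsIndContained K) : InducedFree K G :=
  fun hK => h (hHK.trans hK)

theorem pathGraph_five_isIndContained_subdividedClaw :
    (SimpleGraph.pathGraph 5).IsIndContained (subdividedClaw 2) := by
  refine ⟨⟨⟨![some (0, 1), some (0, 0), none, some (1, 0), some (1, 1)], by decide⟩, ?_⟩⟩
  simp only [SimpleGraph.pathGraph_adj]
  decide

theorem pathGraph_five_isIndContained_subdividedNet :
    (SimpleGraph.pathGraph 5).IsIndContained (subdividedNet 2) := by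
  refine ⟨⟨⟨![(0, 2), (0, 1), (0, 0), (1, 0), (1, 1)], by decide⟩, ?_⟩⟩
  simp only [SimpleGraph.pathGraph_adj]
  decide

/-- A graph is not AT-free if it contains an induced copy of a graph `H` with an asteroidal triple
`t`, where the walks `l i j k` in `H` from `t i` to `t j` that avoid the closed neighbourhood of
`t k` are given as lists of vertices. -/
theorem ATFree.inducedFree {V W : Type*} {G : SimpleGraph V} (hG : ATFree G)
    {H : SimpleGraph W} (t : Fin 3 → W) (ht : Function.Injective t)
    (hind : ∀ i j, ¬ H.Adj (t i) (t j))
    (h : ∀ i j k, i ≠ k → j ≠ k → i ≠ j →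
      ∃ (hi : t i ∈ awayFrom H (t k)) (hj : t j ∈ awayFrom H (t k)),
        (H.induce (awayFrom H (t k))).Reachable ⟨t i, hi⟩ ⟨t j, hj⟩) :
    InducedFree H G := by
  classical
  rintro ⟨f⟩
  have haway : ∀ w k, w ∈ awayFrom H k → f w ∈ awayFrom G (f k) := by
    intro w k hw
    simpa [awayFrom, f.injective.eq_iff] using hw
  refine hG ⟨Finset.univ.image (f ∘ t), ?_, ?_, ?_⟩
  · rw [Finset.card_image_of_injective _ (f.injective.comp ht)]; simp
  · intro x hx y hy _
    simp only [Finset.coe_image, Finset.coe_univ, Set.image_univ, Set.mem_range,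
      Function.comp] at hx hy
    obtain ⟨i, rfl⟩ := hx
    obtain ⟨j, rfl⟩ := hy
    simpa using hind i j
  · simp only [Finset.mem_image, Finset.mem_univ, true_and, Function.comp]
    rintro _ ⟨k, rfl⟩ _ ⟨i, rfl⟩ _ ⟨j, rfl⟩ hik hjk hij
    obtain ⟨hi, hj, hr⟩ := h i j k (fun h => hik (by rw [h])) (fun h => hjk (by rw [h]))
      (fun h => hij (by rw [h]))
    refine ⟨haway _ _ hi, haway _ _ hj, ?_⟩
    let g : H.induce (awayFrom H (t k)) →g G.induce (awayFrom G (f (t k))) :=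
      ⟨fun w => ⟨f w, haway _ _ w.2⟩, fun {a b} hab => by simpa using hab⟩
    exact hr.map g

theorem reachable_induce_of_isChain {W : Type*} {H : SimpleGraph W} {s : Set W} (l : List W) :
    ∀ {x y : W} (hx : x ∈ s) (hy : y ∈ s), (∀ z ∈ l, z ∈ s) →
      (x :: l).IsChain H.Adj → (x :: l).getLast (by simp) = y →
      (H.induce s).Reachable ⟨x, hx⟩ ⟨y, hy⟩ := by
  induction l with
  | nil => rintro x y hx hy - - rfl; rfl
  | cons a l ih =>
    intro x y hx hy hl hc hlast
    rw [List.isChain_cons_cons] at hc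
    have h1 : (H.induce s).Adj ⟨x, hx⟩ ⟨a, hl a (by simp)⟩ := hc.1
    exact h1.reachable.trans (ih _ hy (fun z hz => hl z (by simp [hz])) hc.2 (by simpa using hlast))

theorem ATFree.inducedFree_subdividedClaw {V : Type*} {G : SimpleGraph V} (hG : ATFree G) :
    InducedFree (subdividedClaw 2) G := by
  refine hG.inducedFree (fun i => some (i, 1)) (by decide) ?_ ?_
  · decide
  intro i j k hik hjk hij
  -- Only vertices of leg `k` are equal or adjacent to its tip, so the walk through the centre
  -- between the other two tips avoids it.
  have key : ∀ z : Option (Fin 3 × Fin 2), (∀ a, z ≠ some (k, a)) →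
      z ∈ awayFrom (subdividedClaw 2) (some (k, 1)) := by
    simp only [awayFrom, Set.mem_compl_iff, Set.mem_insert_iff, SimpleGraph.mem_neighborSet]
    clear hik hjk
    revert k; decide
  refine ⟨key _ (by simp [hik]), key _ (by simp [hjk]),
    reachable_induce_of_isChain [some (i, 0), none, some (j, 0), some (j, 1)] _ _ ?_ ?_ (by simp)⟩
  · simp only [List.mem_cons, List.not_mem_nil, or_false]
    rintro z (rfl | rfl | rfl | rfl) <;> apply key <;> simp [hik, hjk]
  · simp [subdividedClaw]

theorem ATFree.inducedFree_subdividedNet {V : Type*} {G : SimpleGraph V} (hG : ATFree G) :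
    InducedFree (subdividedNet 2) G := by
  refine hG.inducedFree (fun i => (i, 2)) (by decide) ?_ ?_
  · decide
  intro i j k hik hjk hij
  have key : ∀ z : Fin 3 × Fin 3, (∀ a, z ≠ (k, a)) →
      z ∈ awayFrom (subdividedNet 2) (k, 2) := by
    simp only [awayFrom, Set.mem_compl_iff, Set.mem_insert_iff, SimpleGraph.mem_neighborSet]
    clear hik hjk
    revert k; decide
  refine ⟨key _ (by simp [hik]), key _ (by simp [hjk]),
    reachable_induce_of_isChain [(i, 1), (i, 0), (j, 0), (j, 1), (j, 2)] _ _ ?_ ?_ (by simp)⟩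
  · simp only [List.mem_cons, List.not_mem_nil, or_false]
    rintro z (rfl | rfl | rfl | rfl | rfl) <;> apply key <;> simp [hik, hjk]
  · simp [subdividedNet, hij]

/-- In a linear order, two of three points other than `c` lie on the same side of `c`. -/
theorem exists_same_side {α : Type*} [LinearOrder α] (c : α) (q : Fin 3 → α) :
    ∃ i j, i ≠ j ∧ (q i ∈ Set.Icc c (q j) ∨ q i ∈ Set.Icc (q j) c) := by
  have key : ∃ i j, i ≠ j ∧ (q i < c ↔ q j < c) := by
    by_cases h0 : q 0 < c <;> by_cases h1 : q 1 < c <;> by_cases h2 : q 2 < c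
    all_goals first
      | exact ⟨0, 1, by decide, iff_of_true h0 h1⟩
      | exact ⟨0, 1, by decide, iff_of_false h0 h1⟩
      | exact ⟨0, 2, by decide, iff_of_true h0 h2⟩
      | exact ⟨0, 2, by decide, iff_of_false h0 h2⟩
      | exact ⟨1, 2, by decide, iff_of_true h1 h2⟩
      | exact ⟨1, 2, by decide, iff_of_false h1 h2⟩
  obtain ⟨i, j, hij, h⟩ := key
  by_cases hi : q i < c
  · rcases le_total (q i) (q j) with h' | h'
    · exact ⟨j, i, hij.symm, .inr ⟨h', (h.1 hi).le⟩⟩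
    · exact ⟨i, j, hij, .inr ⟨h', hi.le⟩⟩
  · have hj : ¬ q j < c := fun hj => hi (h.2 hj)
    rw [not_lt] at hi hj
    rcases le_total (q i) (q j) with h' | h'
    · exact ⟨i, j, hij, .inl ⟨hi, h'⟩⟩
    · exact ⟨j, i, hij.symm, .inl ⟨hj, h'⟩⟩

/-- The centre and the three tips lie in one part. Of two tips on the same side of the centre, the
nearer lies between the centre and the farther, so convexity makes it adjacent to the middle vertex
of the wrong leg. -/
theorem not_ordConnected_of_subdividedClaw {V : Type*} {G : SimpleGraph V} {A B : Set V}
    (f : subdividedClaw 2 ↪g G) [LinearOrder A]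
    (hA : ∀ b : B, Set.OrdConnected {a : A | G.Adj b a}) (hc : f none ∈ A)
    (hp : ∀ i, f (some (i, 0)) ∈ B) (hq : ∀ i, f (some (i, 1)) ∈ A) : False := by
  obtain ⟨i, j, hij, h⟩ := exists_same_side (⟨f none, hc⟩ : A) (fun i => ⟨f (some (i, 1)), hq i⟩)
  have h1 : (⟨f none, hc⟩ : A) ∈ {a : A | G.Adj (f (some (j, 0))) a} :=
    f.map_adj_iff.2 (by simp [subdividedClaw])
  have h2 : (⟨f (some (j, 1)), hq j⟩ : A) ∈ {a : A | G.Adj (f (some (j, 0))) a} :=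
    f.map_adj_iff.2 (by simp [subdividedClaw])
  have h3 : (⟨f (some (i, 1)), hq i⟩ : A) ∈ {a : A | G.Adj (f (some (j, 0))) a} := by
    rcases h with h | h
    · exact (hA ⟨_, hp j⟩).out h1 h2 h
    · exact (hA ⟨_, hp j⟩).out h2 h1 h
  have h4 := f.map_adj_iff.1 h3
  simp [subdividedClaw, hij, hij.symm] at h4

theorem Biconvex.inducedFree_subdividedClaw {V : Type*} {G : SimpleGraph V} (hG : Biconvex G) :
    InducedFree (subdividedClaw 2) G := by
  rintro ⟨f⟩
  obtain ⟨A, B, hAB, hbip, _, _, hA, hB⟩ := hG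
  have hadj1 : ∀ i, G.Adj (f none) (f (some (i, 0))) := fun i =>
    f.map_adj_iff.2 (by simp [subdividedClaw])
  have hadj2 : ∀ i, G.Adj (f (some (i, 0))) (f (some (i, 1))) := fun i =>
    f.map_adj_iff.2 (by simp [subdividedClaw])
  have hmem : f none ∈ A ∪ B := hAB ▸ Set.mem_univ _
  rcases hmem with hc | hc
  · have hp := fun i => hbip.mem_of_mem_adj hc (hadj1 i)
    exact not_ordConnected_of_subdividedClaw f hA hc hp
      (fun i => hbip.symm.mem_of_mem_adj (hp i) (hadj2 i))
  · have hp := fun i => hbip.symm.mem_of_mem_adj hc (hadj1 i)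
    exact not_ordConnected_of_subdividedClaw f hB hc hp
      (fun i => hbip.mem_of_mem_adj (hp i) (hadj2 i))

/-- The net contains a triangle, so bipartiteness suffices. -/
theorem Biconvex.inducedFree_subdividedNet {V : Type*} {G : SimpleGraph V} (hG : Biconvex G) :
    InducedFree (subdividedNet 2) G := by
  rintro ⟨f⟩
  obtain ⟨A, B, hAB, hbip, -⟩ := hG
  have hadj : ∀ i j, i ≠ j → G.Adj (f (i, 0)) (f (j, 0)) :=
    fun i j hij => f.map_adj_iff.2 (by simp [subdividedNet, hij])
  have hdis := hbip.disjoint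
  have hmem : f (0, 0) ∈ A ∪ B := hAB ▸ Set.mem_univ _
  rcases hmem with h0 | h0
  · have h1 := hbip.mem_of_mem_adj h0 (hadj 0 1 (by decide))
    have h2 := hbip.mem_of_mem_adj h0 (hadj 0 2 (by decide))
    exact hdis.le_bot ⟨hbip.symm.mem_of_mem_adj h1 (hadj 1 2 (by decide)), h2⟩
  · have h1 := hbip.symm.mem_of_mem_adj h0 (hadj 0 1 (by decide))
    have h2 := hbip.symm.mem_of_mem_adj h0 (hadj 0 2 (by decide))
    exact hdis.le_bot ⟨h2, hbip.mem_of_mem_adj h1 (hadj 1 2 (by decide))⟩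

/-! ### Rooted longest induced paths -/

/-- The vertices `c 0, …, c d` form an induced path of `G`, in this order, inside `X`. -/
structure IsInducedPath {V : Type*} (G : SimpleGraph V) (X : Set V) (c : ℕ → V) (d : ℕ) :
    Prop where
  mem : ∀ i ≤ d, c i ∈ X
  inj : ∀ i ≤ d, ∀ j ≤ d, c i = c j → i = j
  adj_iff : ∀ i ≤ d, ∀ j ≤ d, (G.Adj (c i) (c j) ↔ i + 1 = j ∨ j + 1 = i)

/-- `G[X]` has no claw and no net with a leaf that is equal to `r` or that has a neighbour in `X`
which is not adjacent to any other vertex of the claw or net, and no three independent vertices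
of `X` are adjacent to `r`. -/
structure RootedClawNetFree {V : Type*} (G : SimpleGraph V) (X : Set V) (r : V) : Prop where
  claw : ∀ c ∈ X, ∀ p ∈ X, ∀ x ∈ X, ∀ y ∈ X, G.Adj c p → G.Adj c x → G.Adj c y →
    ¬ G.Adj p x → ¬ G.Adj p y → ¬ G.Adj x y → p ≠ x → p ≠ y → x ≠ y →
    (p = r ∨ ∃ q ∈ X, G.Adj p q ∧ q ≠ c ∧ ¬ G.Adj q c ∧ ¬ G.Adj q x ∧ ¬ G.Adj q y) → False
  net : ∀ a ∈ X, ∀ b ∈ X, ∀ c ∈ X, ∀ p ∈ X, ∀ x ∈ X, ∀ y ∈ X, G.Adj a b → G.Adj a c → G.Adj b c →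
    G.Adj a p → G.Adj b x → G.Adj c y → ¬ G.Adj a x → ¬ G.Adj a y → ¬ G.Adj b p → ¬ G.Adj b y →
    ¬ G.Adj c p → ¬ G.Adj c x → ¬ G.Adj p x → ¬ G.Adj p y → ¬ G.Adj x y →
    (p = r ∨ ∃ q ∈ X, G.Adj p q ∧ q ≠ a ∧ ¬ G.Adj q a ∧ ¬ G.Adj q b ∧ ¬ G.Adj q c ∧
      ¬ G.Adj q x ∧ ¬ G.Adj q y) → False
  triple : ∀ x ∈ X, ∀ y ∈ X, ∀ z ∈ X, G.Adj r x → G.Adj r y → G.Adj r z → x ≠ y → x ≠ z → y ≠ z →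
    ¬ G.Adj x y → ¬ G.Adj x z → ¬ G.Adj y z → False

/-- The set `X` induces a connected subgraph, expressed by edges across cuts. -/
def CutConnected {V : Type*} (G : SimpleGraph V) (X : Set V) : Prop :=
  ∀ S ⊆ X, S.Nonempty → (X \ S).Nonempty → ∃ a ∈ S, ∃ b ∈ X \ S, G.Adj a b

section

variable {V : Type*} {G : SimpleGraph V} {X : Set V} {c : ℕ → V} {d : ℕ}

theorem IsInducedPath.mono_length (h : IsInducedPath G X c d) {k : ℕ} (hk : k ≤ d) :
    IsInducedPath G X c k :=
  ⟨fun i hi => h.mem i (hi.trans hk), fun i hi j hj => h.inj i (hi.trans hk) j (hj.trans hk),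
    fun i hi j hj => h.adj_iff i (hi.trans hk) j (hj.trans hk)⟩

theorem IsInducedPath.extend (h : IsInducedPath G X c d) {w : V} (hw : w ∈ X)
    (hne : ∀ i ≤ d, c i ≠ w) (hadj : ∀ i ≤ d, (G.Adj (c i) w ↔ i = d)) :
    IsInducedPath G X (fun i => if i ≤ d then c i else w) (d + 1) where
  mem i _ := by
    split_ifs with hid
    · exact h.mem i hid
    · exact hw
  inj i hi j hj hij := by
    split_ifs at hij with h1 h2 h2
    · exact h.inj i h1 j h2 hij
    · exact absurd hij (hne i h1)
    · exact absurd hij.symm (hne j h2)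
    · omega
  adj_iff i hi j hj := by
    split_ifs with h1 h2 h2
    · exact h.adj_iff i h1 j h2
    · rw [hadj i h1]; omega
    · rw [G.adj_comm, hadj j h2]; omega
    · simp only [SimpleGraph.irrefl, false_iff]; omega

theorem IsInducedPath.reverse (h : IsInducedPath G X c d) :
    IsInducedPath G X (fun i => c (d - i)) d where
  mem i _ := h.mem _ (by omega)
  inj i hi j hj hij := by
    have := h.inj _ (by omega) _ (by omega) hij
    omega
  adj_iff i hi j hj := by
    rw [h.adj_iff _ (by omega) _ (by omega)]
    omega

theorem IsInducedPath.lt_card [Finite V] (h : IsInducedPath G X c d) : d < Nat.card V := by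
  have : Function.Injective (fun i : Fin (d + 1) => c i) := fun i j hij =>
    Fin.ext (h.inj i (by omega) j (by omega) hij)
  have := Nat.card_le_card_of_injective _ this
  simp at this
  omega

/-- A longest induced path starting at `r` dominates `X`, provided that this is not spoiled by
neighbours of `r`. -/
theorem IsInducedPath.dominates (h : IsInducedPath G X c d) (hX : CutConnected G X)
    (hfree : RootedClawNetFree G X (c 0))
    (hmax : ∀ c', IsInducedPath G X c' (d + 1) → c' 0 ≠ c 0)
    (hroot : ∀ w ∈ X, ∀ w' ∈ X, (∀ i ≤ d, c i ≠ w) → G.Adj (c 0) w → G.Adj w w' →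
      ∃ i ≤ d, c i = w' ∨ G.Adj (c i) w') :
    ∀ w ∈ X, ∃ i ≤ d, c i = w ∨ G.Adj (c i) w := by
  classical
  by_contra! hcon
  obtain ⟨w₀, hw₀, hw₀'⟩ := hcon
  -- An edge `w w'` from a dominated to an undominated vertex.
  obtain ⟨w, ⟨hw, i, hi, hiw⟩, w', ⟨hw', hw''⟩, hww'⟩ :=
    hX {w | w ∈ X ∧ ∃ i ≤ d, c i = w ∨ G.Adj (c i) w} (fun w hw => hw.1)
      ⟨c 0, h.mem 0 (by omega), 0, by omega, .inl rfl⟩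
      ⟨w₀, hw₀, fun hw => by
        obtain ⟨i, hi, h1 | h1⟩ := hw.2
        · exact (hw₀' i hi).1 h1
        · exact (hw₀' i hi).2 h1⟩
  have hund : ∀ i ≤ d, c i ≠ w' ∧ ¬ G.Adj (c i) w' := fun i hi =>
    ⟨fun h1 => hw'' ⟨hw', i, hi, .inl h1⟩, fun h1 => hw'' ⟨hw', i, hi, .inr h1⟩⟩
  have hwne : ∀ i ≤ d, c i ≠ w := fun i hi h1 => (hund i hi).2 (h1 ▸ hww')
  have hiw : G.Adj (c i) w := hiw.resolve_left (hwne i hi)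
  have hex : ∃ j, j ≤ d ∧ G.Adj (c j) w := ⟨i, hi, hiw⟩
  obtain ⟨j, ⟨hjd, hjw⟩, hjmin⟩ : ∃ j, (j ≤ d ∧ G.Adj (c j) w) ∧ ∀ i < j, ¬ G.Adj (c i) w := by
    refine ⟨Nat.find hex, Nat.find_spec hex, fun i hi hiw => Nat.find_min hex hi ⟨?_, hiw⟩⟩
    exact hi.le.trans (Nat.find_spec hex).1
  have hj0 : j ≠ 0 := by
    rintro rfl
    obtain ⟨i, hi, h1⟩ := hroot w hw w' hw' hwne hjw hww'
    rcases h1 with h1 | h1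
    · exact (hund i hi).1 h1
    · exact (hund i hi).2 h1
  have hadj : ∀ i ≤ d, ∀ k ≤ d, (i + 1 = k ∨ k + 1 = i) → G.Adj (c i) (c k) :=
    fun i hi k hk h1 => (h.adj_iff i hi k hk).2 h1
  have hnadj : ∀ i ≤ d, ∀ k ≤ d, ¬ (i + 1 = k ∨ k + 1 = i) → ¬ G.Adj (c i) (c k) :=
    fun i hi k hk h1 h2 => h1 ((h.adj_iff i hi k hk).1 h2)
  have hne : ∀ i ≤ d, ∀ k ≤ d, i ≠ k → c i ≠ c k :=
    fun i hi k hk h1 h2 => h1 (h.inj i hi k hk h2)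
  rcases hjd.lt_or_eq with hjd | rfl
  -- Otherwise `c j` is the centre of a claw with leaves `c (j - 1)`, `c (j + 1)`, `w`, anchored by
  -- the root or by `c (j - 2)`.
  · have hj1 : G.Adj (c (j + 1)) w := by
      by_contra hj1
      refine hfree.claw (c j) (h.mem _ (by omega)) (c (j - 1)) (h.mem _ (by omega))
        (c (j + 1)) (h.mem _ (by omega)) w hw (hadj _ (by omega) _ (by omega) (by omega))
        (hadj _ (by omega) _ (by omega) (by omega)) hjw
        (hnadj _ (by omega) _ (by omega) (by omega)) (hjmin _ (by omega)) hj1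
        (hne _ (by omega) _ (by omega) (by omega)) (hwne _ (by omega)) (hwne _ (by omega)) ?_
      by_cases h1 : j = 1
      · left; rw [h1]
      · exact .inr ⟨c (j - 2), h.mem _ (by omega), hadj _ (by omega) _ (by omega) (by omega),
          hne _ (by omega) _ (by omega) (by omega),
          hnadj _ (by omega) _ (by omega) (by omega), hnadj _ (by omega) _ (by omega) (by omega),
          hjmin _ (by omega)⟩
    -- Otherwise `w` is the centre of a claw with leaves `c j`, `c k`, `w'`, anchored by `c (j -
    -- 1)`.
    have hfar : ∀ k ≤ d, j + 2 ≤ k → ¬ G.Adj (c k) w := by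
      intro k hk hjk hkw
      exact hfree.claw w hw (c j) (h.mem _ (by omega)) (c k) (h.mem _ hk) w' hw' hjw.symm hkw.symm
        hww' (hnadj _ (by omega) _ (by omega) (by omega)) (hund _ (by omega)).2 (hund _ hk).2
        (hne _ (by omega) _ (by omega) (by omega)) (hund _ (by omega)).1 (hund _ hk).1
        (.inr ⟨c (j - 1), h.mem _ (by omega), hadj _ (by omega) _ (by omega) (by omega),
          hwne _ (by omega), hjmin _ (by omega), hnadj _ (by omega) _ (by omega) (by omega),
          (hund _ (by omega)).2⟩)
    -- Now `w` sees exactly `c j` and `c (j + 1)`. At the end of the path, replacing `c d` by `w,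
    -- w'` gains an edge; elsewhere this triangle carries an anchored net.
    by_cases hj2 : j + 1 = d
    · have h1 : IsInducedPath G X _ (j + 1) := (h.mono_length hjd.le).extend hw
        (fun i hi => hwne i (by omega)) fun i hi =>
          ⟨fun h1 => by_contra fun h2 => hjmin i (by omega) h1, fun h1 => h1 ▸ hjw⟩
      refine hmax _ (hj2 ▸ h1.extend hw' ?_ ?_) (by simp)
      · intro i hi
        split_ifs with h2
        · exact (hund i (by omega)).1
        · exact hww'.ne
      · intro i hi
        split_ifs with h2
        · simp only [(hund i (by omega)).2, false_iff]; omega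
        · simp only [hww', true_iff]; omega
    · refine hfree.net (c j) (h.mem _ (by omega)) (c (j + 1)) (h.mem _ (by omega)) w hw
        (c (j - 1)) (h.mem _ (by omega)) (c (j + 2)) (h.mem _ (by omega)) w' hw'
        (hadj _ (by omega) _ (by omega) (by omega)) hjw hj1
        (hadj _ (by omega) _ (by omega) (by omega)) (hadj _ (by omega) _ (by omega) (by omega))
        hww' (hnadj _ (by omega) _ (by omega) (by omega)) (hund _ (by omega)).2
        (hnadj _ (by omega) _ (by omega) (by omega)) (hund _ (by omega)).2
        (fun h1 => hjmin _ (by omega) h1.symm) (fun h1 => hfar _ (by omega) le_rfl h1.symm)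
        (hnadj _ (by omega) _ (by omega) (by omega)) (hund _ (by omega)).2
        (hund _ (by omega)).2 ?_
      by_cases h1 : j = 1
      · left; rw [h1]
      · exact .inr ⟨c (j - 2), h.mem _ (by omega), hadj _ (by omega) _ (by omega) (by omega),
          hne _ (by omega) _ (by omega) (by omega),
          hnadj _ (by omega) _ (by omega) (by omega), hnadj _ (by omega) _ (by omega) (by omega),
          hjmin _ (by omega), hnadj _ (by omega) _ (by omega) (by omega), (hund _ (by omega)).2⟩
  · exact hmax _ (h.extend hw hwne fun i hi =>
      ⟨fun h1 => by_contra fun h2 => hjmin i (by omega) h1, fun h1 => h1 ▸ hjw⟩) (by simp)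

/-! ### Hamiltonian paths from dominating induced paths -/

/-- If the neighbours `W` of `r` contain no independent triple, then `W ∪ {r}` has a Hamiltonian
path that starts at a given vertex `z` of `W`. -/
theorem exists_hamiltonian_list_of_neighbors [Finite V] (W : Set V) (r z : V) (hz : z ∈ W)
    (hr : ∀ w ∈ W, G.Adj r w)
    (htriple : ∀ x ∈ W, ∀ y ∈ W, ∀ z ∈ W, x ≠ y → x ≠ z → y ≠ z →
      ¬ G.Adj x y → ¬ G.Adj x z → ¬ G.Adj y z → False) :
    ∃ l : List V, (z :: l).Nodup ∧ (z :: l).IsChain G.Adj ∧ ∀ v, v ∈ z :: l ↔ v = r ∨ v ∈ W := by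
  classical
  cases nonempty_fintype V
  let good : List V → Prop := fun m => m.head? = some z ∧ m.Nodup ∧ m.IsChain G.Adj ∧
    ∀ v ∈ m, v = r ∨ v ∈ W
  have hrW : r ∉ W := fun h => (hr r h).ne rfl
  obtain ⟨m, hm, hmax⟩ : ∃ m, good m ∧ ∀ m', good m' → m'.length ≤ m.length := by
    have hfin : {m : List V | good m}.Finite :=
      (List.finite_length_le V (Fintype.card V)).subset fun m hm => hm.2.1.length_le_card
    obtain ⟨m, hm, h⟩ := Set.exists_max_image _ List.length hfin ⟨[z], by simp [good, hz]⟩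
    exact ⟨m, hm, h⟩
  obtain ⟨hhead, hnd, hch, hsub⟩ := hm
  have hmne : m ≠ [] := by rintro rfl; simp at hhead
  have happ : ∀ u, (u = r ∨ u ∈ W) → G.Adj (m.getLast hmne) u → u ∈ m := by
    intro u hu hadj
    by_contra hum
    have := hmax (m ++ [u]) ⟨by simp [hhead], ?_, ?_, ?_⟩
    · simp at this
    · rw [List.nodup_append]; refine ⟨hnd, by simp, ?_⟩; simp; rintro a ha rfl; exact hum ha
    · rw [List.isChain_append]; refine ⟨hch, by simp, ?_⟩
      simpa [List.getLast?_eq_getLast_of_ne_nil hmne] using hadj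
    · intro v hv; rw [List.mem_append] at hv
      rcases hv with hv | hv
      · exact hsub v hv
      · simp at hv; exact hv ▸ hu
  have hrm : r ∈ m := by
    rcases hsub _ (List.getLast_mem hmne) with h1 | h1
    · exact h1 ▸ List.getLast_mem hmne
    · exact happ r (.inl rfl) (hr _ h1).symm
  -- Let `a` precede `r` and `e` be last on a longest path `m`. A missed `u` is adjacent to neither,
  -- by maximality, so `a` and `e` are adjacent. Jumping from `a` to `e`, going back to `r` and then
  -- to `u` gives a longer path.
  have hall : ∀ u ∈ W, u ∈ m := by
    intro u hu
    by_contra hum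
    have hur : u ≠ r := fun h => hrW (h ▸ hu)
    obtain ⟨s, t, rfl⟩ := List.append_of_mem hrm
    rcases List.eq_nil_or_concat' s with rfl | ⟨s, a, rfl⟩
    · simp at hhead; exact hrW (hhead ▸ hz)
    rcases List.eq_nil_or_concat' t with rfl | ⟨t, e, rfl⟩
    · exact hum (happ u (.inr hu) (by simpa using hr u hu))
    have hlast : (s ++ [a] ++ r :: (t ++ [e])).getLast hmne = e := by simp
    rw [hlast] at happ
    have ha : a ∈ W := by
      refine (hsub a (by simp)).resolve_left ?_
      rintro rfl
      simp [List.nodup_append] at hnd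
    have he : e ∈ W := by
      refine (hsub e (by simp)).resolve_left ?_
      rintro rfl
      simp [List.nodup_append] at hnd
    have hae : a ≠ e := by
      rintro rfl
      simp [List.nodup_append] at hnd
    have heu : ¬ G.Adj e u := fun h => hum (happ u (.inr hu) h)
    have hau : ¬ G.Adj a u := by
      intro hau
      have := hmax (s ++ [a] ++ u :: r :: (t ++ [e])) ⟨?_, ?_, ?_, ?_⟩
      · simp at this
      · cases s <;> simpa using hhead
      · have : (s ++ [a] ++ u :: r :: (t ++ [e])).Perm (u :: (s ++ [a] ++ r :: (t ++ [e]))) :=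
          List.perm_middle
        rw [this.nodup_iff, List.nodup_cons]
        exact ⟨hum, hnd⟩
      · rw [List.isChain_append] at hch ⊢
        refine ⟨hch.1, ?_, by simpa using hau⟩
        rw [List.isChain_cons_cons]
        exact ⟨(hr u hu).symm, hch.2.1⟩
      · intro v hv
        have : v = u ∨ v ∈ s ++ [a] ++ r :: (t ++ [e]) := by
          simp at hv ⊢; tauto
        rcases this with rfl | h1
        · exact .inr hu
        · exact hsub v h1
    have hae' : G.Adj a e := by
      by_contra hae'
      exact htriple a ha e he u hu hae (fun h => hum (by simp [← h])) (fun h => hum (by simp [← h]))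
        hae' hau heu
    have := hmax (s ++ [a] ++ ((t ++ [e]).reverse ++ [r, u])) ⟨?_, ?_, ?_, ?_⟩
    · simp at this
    · cases s <;> simpa using hhead
    · have : (s ++ [a] ++ ((t ++ [e]).reverse ++ [r, u])).Perm
          (u :: (s ++ [a] ++ r :: (t ++ [e]))) := by
        have h1 : ((t ++ [e]).reverse ++ [r, u]).Perm (u :: r :: (t ++ [e])) := by
          refine List.perm_append_comm.trans ?_
          refine (List.Perm.swap u r _).trans ?_
          exact ((List.reverse_perm _).cons _).cons _
        exact (h1.append_left _).trans List.perm_middle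
      rw [this.nodup_iff, List.nodup_cons]
      exact ⟨hum, hnd⟩
    · rw [List.isChain_append] at hch ⊢
      refine ⟨hch.1, ?_, by simpa using hae'⟩
      rw [List.isChain_append]
      have h2 := hch.2.1
      rw [List.isChain_cons] at h2
      refine ⟨?_, by simpa using hr u hu, ?_⟩
      · rw [List.isChain_reverse]
        exact h2.2.imp fun _ _ h => h.symm
      · intro x hx y hy
        rw [List.getLast?_reverse] at hx
        simp at hy
        exact hy ▸ (h2.1 x hx).symm
    · intro v hv
      have : v = u ∨ v ∈ s ++ [a] ++ r :: (t ++ [e]) := by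
        simp at hv ⊢; tauto
      rcases this with rfl | h1
      · exact .inr hu
      · exact hsub v h1
  obtain _ | ⟨z', l⟩ := m
  · simp at hhead
  simp at hhead
  subst hhead
  refine ⟨l, hnd, hch, fun v => ⟨hsub v, ?_⟩⟩
  rintro (rfl | h1)
  · exact hrm
  · exact hall v h1

end

section

variable {V : Type*} {G : SimpleGraph V} {X : Set V} {c : ℕ → V} {d : ℕ}

/-- The vertices of `X` outside the neighbourhood of the initial segment `c 0, …, c (k - 1)` of a
dominating induced path, together with `c k`, have a Hamiltonian path starting at `c k`. -/
theorem IsInducedPath.exists_list_from [Finite V] (h : IsInducedPath G X c d)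
    (hfree : RootedClawNetFree G X (c 0))
    (hmax : ∀ c', IsInducedPath G X c' (d + 1) → c' 0 ≠ c 0)
    (hdom : ∀ w ∈ X, ∃ i ≤ d, c i = w ∨ G.Adj (c i) w) (n k : ℕ) (hk : 1 ≤ k) (hkd : k + n = d) :
    ∃ l : List V, (c k :: l).Nodup ∧ (c k :: l).IsChain G.Adj ∧
      ∀ v, v ∈ c k :: l ↔ v = c k ∨ (v ∈ X ∧ ∀ i < k, c i ≠ v ∧ ¬ G.Adj (c i) v) := by
  classical
  cases nonempty_fintype V
  induction n generalizing k with
  | zero =>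
    obtain rfl : k = d := by omega
    refine ⟨[], by simp, by simp, fun v => ?_⟩
    simp only [List.mem_singleton]
    refine ⟨.inl, ?_⟩
    rintro (hv | ⟨hv, hv'⟩)
    · exact hv
    by_contra hne
    obtain ⟨i, hi, h1⟩ := hdom v hv
    have hik : i = k := by
      by_contra hik
      rcases h1 with h1 | h1
      · exact (hv' i (by omega)).1 h1
      · exact (hv' i (by omega)).2 h1
    subst hik
    have h1 := h1.resolve_left fun h2 => hne h2.symm
    refine hmax _ (h.extend hv (fun j hj h2 => ?_) fun j hj =>
      ⟨fun h2 => by_contra fun h3 => (hv' j (by omega)).2 h2, fun h2 => h2 ▸ h1⟩) (by simp)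
    rcases hj.lt_or_eq with h3 | rfl
    · exact (hv' j h3).1 h2
    · exact hne h2.symm
  | succ n ih =>
    obtain ⟨l, hnd, hch, hmem⟩ := ih (k + 1) (by omega) (by omega)
    have hadj : ∀ i ≤ d, ∀ k ≤ d, (i + 1 = k ∨ k + 1 = i) → G.Adj (c i) (c k) :=
      fun i hi k hk h1 => (h.adj_iff i hi k hk).2 h1
    have hnadj : ∀ i ≤ d, ∀ k ≤ d, ¬ (i + 1 = k ∨ k + 1 = i) → ¬ G.Adj (c i) (c k) :=
      fun i hi k hk h1 h2 => h1 ((h.adj_iff i hi k hk).1 h2)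
    have hne : ∀ i ≤ d, ∀ k ≤ d, i ≠ k → c i ≠ c k :=
      fun i hi k hk h1 h2 => h1 (h.inj i hi k hk h2)
    have hanchor : ∀ x y, (∀ i < k, ¬ G.Adj (c i) x) → (∀ i < k, ¬ G.Adj (c i) y) →
        (c (k - 1) = c 0 ∨ ∃ q ∈ X, G.Adj (c (k - 1)) q ∧ q ≠ c k ∧ ¬ G.Adj q (c k) ∧
          ¬ G.Adj q x ∧ ¬ G.Adj q y) := by
      intro x y hx hy
      by_cases h1 : k = 1
      · left; rw [h1]
      · exact .inr ⟨c (k - 2), h.mem _ (by omega), hadj _ (by omega) _ (by omega) (by omega),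
          hne _ (by omega) _ (by omega) (by omega),
          hnadj _ (by omega) _ (by omega) (by omega), hx _ (by omega), hy _ (by omega)⟩
    -- The new vertices attached at `c k`. Two nonadjacent ones, or one not adjacent to `c (k + 1)`,
    -- would give a claw at `c k` anchored through `c (k - 1)`. Hence `U` can be inserted in any
    -- order between `c k` and `c (k + 1)`.
    let U : Finset V := Finset.univ.filter fun u => (u ∈ X ∧ ∀ i < k, c i ≠ u ∧ ¬ G.Adj (c i) u) ∧
      G.Adj (c k) u ∧ u ≠ c (k + 1)
    have hU : ∀ u, u ∈ U ↔ (u ∈ X ∧ ∀ i < k, c i ≠ u ∧ ¬ G.Adj (c i) u) ∧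
      G.Adj (c k) u ∧ u ≠ c (k + 1) := by simp [U]
    have hclique : ∀ u ∈ U, ∀ v ∈ U, u ≠ v → G.Adj u v := by
      intro u hu v hv huv
      rw [hU] at hu hv
      by_contra huv'
      exact hfree.claw (c k) (h.mem _ (by omega)) (c (k - 1)) (h.mem _ (by omega)) u hu.1.1 v hv.1.1
        (hadj _ (by omega) _ (by omega) (by omega)) hu.2.1 hv.2.1 (hu.1.2 _ (by omega)).2
        (hv.1.2 _ (by omega)).2 huv' (hu.1.2 _ (by omega)).1 (hv.1.2 _ (by omega)).1 huv
        (hanchor u v (fun i hi => (hu.1.2 i hi).2) (fun i hi => (hv.1.2 i hi).2))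
    have hnext : ∀ u ∈ U, G.Adj u (c (k + 1)) := by
      intro u hu
      rw [hU] at hu
      by_contra huv'
      exact hfree.claw (c k) (h.mem _ (by omega)) (c (k - 1)) (h.mem _ (by omega)) u hu.1.1
        (c (k + 1)) (h.mem _ (by omega))
        (hadj _ (by omega) _ (by omega) (by omega)) hu.2.1 (hadj _ (by omega) _ (by omega) (by omega))
        (hu.1.2 _ (by omega)).2 (hnadj _ (by omega) _ (by omega) (by omega)) huv'
        (hu.1.2 _ (by omega)).1 (hne _ (by omega) _ (by omega) (by omega)) hu.2.2
        (hanchor u _ (fun i hi => (hu.1.2 i hi).2)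
          (fun i hi => hnadj _ (by omega) _ (by omega) (by omega)))
    have hckU : c k ∉ U := fun h1 => ((hU _).1 h1).2.1.ne rfl
    have hck : c k ∉ c (k + 1) :: l := by
      rw [hmem]
      rintro (h1 | h1)
      · exact hne _ (by omega) _ (by omega) (by omega) h1
      · exact (h1.2 k (by omega)).1 rfl
    have hdisj : ∀ u ∈ U, u ∉ c (k + 1) :: l := by
      intro u hu
      rw [hmem]
      rintro (h1 | h1)
      · exact ((hU u).1 hu).2.2 h1
      · exact (h1.2 k (by omega)).2 ((hU u).1 hu).2.1
    have hUch : U.toList.IsChain G.Adj := by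
      refine List.Pairwise.isChain ?_
      refine (U.nodup_toList).imp_of_mem ?_
      intro a b ha hb hab
      exact hclique a (by simpa using ha) b (by simpa using hb) hab
    refine ⟨U.toList ++ c (k + 1) :: l, ?_, ?_, fun v => ?_⟩
    · rw [List.nodup_cons, List.nodup_append]
      refine ⟨?_, U.nodup_toList, hnd, ?_⟩
      · rw [List.mem_append, Finset.mem_toList]
        rintro (h1 | h1)
        · exact hckU h1
        · exact hck h1
      · rintro a ha b hb rfl
        exact hdisj a (by simpa using ha) hb
    · rw [List.isChain_cons, List.isChain_append]
      refine ⟨?_, hUch, hch, ?_⟩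
      · intro y hy
        rcases hl : U.toList with _ | ⟨u, t⟩
        · rw [hl] at hy
          simp at hy
          exact hy ▸ hadj _ (by omega) _ (by omega) (by omega)
        · rw [hl] at hy
          simp at hy
          have : u ∈ U.toList := by rw [hl]; simp
          exact hy ▸ ((hU u).1 (by simpa using this)).2.1
      · intro x hx y hy
        simp at hy
        have := List.mem_of_getLast? hx
        exact hy ▸ hnext x (by simpa using this)
    · rw [List.mem_cons, List.mem_append, Finset.mem_toList, hmem, hU]
      constructor
      · rintro (h1 | h1 | h1 | h1)
        · exact .inl h1
        · exact .inr h1.1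
        · right
          rw [h1]
          exact ⟨h.mem _ (by omega), fun i hi => ⟨hne _ (by omega) _ (by omega) (by omega),
            hnadj _ (by omega) _ (by omega) (by omega)⟩⟩
        · exact .inr ⟨h1.1, fun i hi => h1.2 i (by omega)⟩
      · rintro (h1 | h1)
        · exact .inl h1
        by_cases h2 : v = c k
        · exact .inl h2
        by_cases h3 : v = c (k + 1)
        · exact .inr (.inr (.inl h3))
        by_cases h4 : G.Adj (c k) v
        · exact .inr (.inl ⟨h1, h4, h3⟩)
        · refine .inr (.inr (.inr ⟨h1.1, fun i hi => ?_⟩))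
          rcases (Nat.lt_succ_iff.1 hi).lt_or_eq with h5 | rfl
          · exact h1.2 i h5
          · exact ⟨fun h6 => h2 h6.symm, h4⟩

/-- The closed neighbourhood of the root is traversed first, ending at `c 1`; everything beyond it
is traversed from `c 1` by the layers of `exists_list_from`. -/
theorem IsInducedPath.exists_hamiltonian_list [Finite V] (h : IsInducedPath G X c d)
    (hX : CutConnected G X) (hfree : RootedClawNetFree G X (c 0))
    (hmax : ∀ c', IsInducedPath G X c' (d + 1) → c' 0 ≠ c 0)
    (hroot : ∀ w ∈ X, ∀ w' ∈ X, (∀ i ≤ d, c i ≠ w) → G.Adj (c 0) w → G.Adj w w' →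
      ∃ i ≤ d, c i = w' ∨ G.Adj (c i) w') :
    ∃ l : List V, l ≠ [] ∧ l.Nodup ∧ l.IsChain G.Adj ∧ ∀ v, v ∈ l ↔ v ∈ X := by
  have hdom := h.dominates hX hfree hmax hroot
  rcases Nat.eq_zero_or_pos d with rfl | hd
  · refine ⟨[c 0], by simp, by simp, by simp, fun v => ?_⟩
    rw [List.mem_singleton]
    refine ⟨fun h1 => h1 ▸ h.mem 0 le_rfl, fun hv => ?_⟩
    obtain ⟨i, hi, h1⟩ := hdom v hv
    obtain rfl : i = 0 := by omega
    rcases h1 with h1 | h1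
    · exact h1.symm
    · refine absurd (by simp) (hmax _ (h.extend hv (fun i hi => ?_) (fun i hi => ?_)))
      · obtain rfl : i = 0 := by omega
        exact h1.ne
      · obtain rfl : i = 0 := by omega
        simpa using h1
  obtain ⟨l, hnd, hch, hmem⟩ := h.exists_list_from hfree hmax hdom (d - 1) 1 le_rfl (by omega)
  have h01 : G.Adj (c 0) (c 1) := (h.adj_iff 0 (by omega) 1 (by omega)).2 (by omega)
  obtain ⟨m, hmnd, hmch, hmmem⟩ := exists_hamiltonian_list_of_neighbors (G := G)
    {w | w ∈ X ∧ G.Adj (c 0) w} (c 0) (c 1) ⟨h.mem 1 (by omega), h01⟩ (fun w hw => hw.2)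
    (fun x hx y hy z hz => hfree.triple x hx.1 y hy.1 z hz.1 hx.2 hy.2 hz.2)
  rw [List.nodup_cons] at hmnd
  refine ⟨m.reverse ++ c 1 :: l, by simp, ?_, ?_, fun v => ?_⟩
  · rw [List.nodup_append]
    refine ⟨List.nodup_reverse.2 hmnd.2, hnd, ?_⟩
    rintro a ha b hb rfl
    rw [List.mem_reverse] at ha
    rcases (hmem a).1 hb with h1 | h1
    · exact hmnd.1 (h1 ▸ ha)
    · have := h1.2 0 (by omega)
      rcases (hmmem a).1 (List.mem_cons_of_mem _ ha) with h2 | h2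
      · exact this.1 h2.symm
      · exact this.2 h2.2
  · rw [List.isChain_append]
    rw [List.isChain_cons] at hmch
    refine ⟨?_, hch, ?_⟩
    · rw [List.isChain_reverse]
      exact hmch.2.imp fun _ _ h => h.symm
    · intro x hx y hy
      rw [List.getLast?_reverse] at hx
      simp at hy
      exact hy ▸ (hmch.1 x hx).symm
  · rw [List.mem_append, List.mem_reverse]
    constructor
    · rintro (h1 | h1)
      · rcases (hmmem v).1 (List.mem_cons_of_mem _ h1) with h2 | h2
        · exact h2 ▸ h.mem 0 (by omega)
        · exact h2.1
      · rcases (hmem v).1 h1 with h2 | h2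
        · exact h2 ▸ h.mem 1 (by omega)
        · exact h2.1
    · intro hv
      by_cases h1 : v = c 0 ∨ G.Adj (c 0) v
      · have h2 : v ∈ c 1 :: m := (hmmem v).2 (h1.imp_right fun h2 => ⟨hv, h2⟩)
        rcases List.mem_cons.1 h2 with h3 | h3
        · exact .inr (by simp [h3])
        · exact .inl h3
      · refine .inr ((hmem v).2 (.inr ⟨hv, fun i hi => ?_⟩))
        obtain rfl : i = 0 := by omega
        exact ⟨fun h2 => h1 (.inl h2.symm), fun h2 => h1 (.inr h2)⟩

end

/-! ### Cuts, pendant parts and optimal tailed sets -/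

section

variable {V : Type*} {G : SimpleGraph V} {X : Set V}

theorem CutConnected.singleton (a : V) : CutConnected G {a} := by
  intro S hS ⟨s, hs⟩ ⟨t, ht, hts⟩
  have h1 : s = a := hS hs
  have h2 : t = a := ht
  exact absurd (h2 ▸ h1 ▸ hs) hts

theorem CutConnected.insert (hX : CutConnected G X) {a b : V} (hb : b ∈ X) (hab : G.Adj a b) :
    CutConnected G (insert a X) := by
  intro S hS hS1 ⟨t, ht, htS⟩
  by_cases h1 : (X ∩ S).Nonempty
  · by_cases h2 : (X \ S).Nonempty
    · obtain ⟨u, hu, v, hv, huv⟩ := hX (X ∩ S) Set.inter_subset_left h1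
        (by rwa [Set.sdiff_self_inter])
      exact ⟨u, hu.2, v, ⟨.inr hv.1, fun h => hv.2 ⟨hv.1, h⟩⟩, huv⟩
    · have hXS : X ⊆ S := fun z hz => by_contra fun h => h2 ⟨z, hz, h⟩
      have : t = a := ht.resolve_right fun h => htS (hXS h)
      subst this
      exact ⟨b, hXS hb, t, ⟨.inl rfl, htS⟩, hab.symm⟩
  · obtain ⟨s, hs⟩ := hS1
    have hSX : ∀ z ∈ S, z = a := fun z hz => (hS hz).resolve_right fun h => h1 ⟨z, h, hz⟩
    have := hSX s hs
    subst this
    refine ⟨s, hs, b, ⟨.inr hb, fun h => h1 ⟨b, hb, h⟩⟩, hab⟩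

theorem CutConnected.exists_adj (hX : CutConnected G X) {a b : V} (ha : a ∈ X) (hb : b ∈ X)
    (hab : a ≠ b) : ∃ z ∈ X, G.Adj a z := by
  obtain ⟨u, hu, v, hv, huv⟩ := hX {a} (by simpa using ha) ⟨a, rfl⟩ ⟨b, hb, fun h => hab h.symm⟩
  obtain rfl : u = a := hu
  exact ⟨v, hv.1, huv⟩

/-- `C` is a part of `X` that is attached to the rest of `X` only at `x`. -/
structure IsPendantPart (G : SimpleGraph V) (X : Set V) (x : V) (C : Set V) : Prop where
  subset : C ⊆ X
  notMem : x ∉ C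
  not_adj : ∀ a ∈ C, ∀ b ∈ X, b ≠ x → b ∉ C → ¬ G.Adj a b

/-- Deleting `x` leaves a cut without crossing edges, and the connected set `K` lies on one side of
it. The other side serves as `C`; by connectedness of `X` it has an edge to the rest, which can only
go to `x`. -/
theorem CutConnected.exists_isPendantPart (hX : CutConnected G X) {x : V} (hx : x ∈ X)
    (hcut : ¬ CutConnected G (X \ {x})) {K : Set V} (hKX : K ⊆ X) (hxK : x ∉ K)
    (hK : CutConnected G K) :
    ∃ C, IsPendantPart G X x C ∧ (∀ k ∈ K, k ∉ C) ∧ ∃ x' ∈ C, G.Adj x x' := by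
  have main : ∀ C, C ⊆ X \ {x} → C.Nonempty → (∀ a ∈ C, ∀ b ∈ X, b ≠ x → b ∉ C → ¬ G.Adj a b) →
      (∀ k ∈ K, k ∉ C) →
      ∃ C, IsPendantPart G X x C ∧ (∀ k ∈ K, k ∉ C) ∧ ∃ x' ∈ C, G.Adj x x' := by
    intro C hC hne hadj hCK
    refine ⟨C, ⟨fun z hz => (hC hz).1, fun h => (hC h).2 rfl, hadj⟩, hCK, ?_⟩
    obtain ⟨u, hu, v, hv, huv⟩ := hX C (fun z hz => (hC hz).1) hne ⟨x, hx, fun h => (hC h).2 rfl⟩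
    by_cases hvx : v = x
    · exact ⟨u, hu, hvx ▸ huv.symm⟩
    · exact absurd huv (hadj u hu v hv.1 hvx hv.2)
  unfold CutConnected at hcut
  push Not at hcut
  obtain ⟨S, hS, hS1, hS2, hSadj⟩ := hcut
  by_cases h1 : (K ∩ S).Nonempty
  · have hKS : ∀ k ∈ K, k ∈ S := by
      intro k hk
      by_contra hkS
      obtain ⟨u, hu, v, hv, huv⟩ := hK (K ∩ S) Set.inter_subset_left h1 ⟨k, hk, fun h => hkS h.2⟩
      exact hSadj u hu.2 v ⟨⟨hKX hv.1, fun h => hxK (h ▸ hv.1)⟩, fun h => hv.2 ⟨hv.1, h⟩⟩ huv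
    refine main _ Set.sdiff_subset hS2 (fun a ha b hb hbx hbC hab => ?_) fun k hk h => h.2 (hKS k hk)
    refine hSadj b ?_ a ha hab.symm
    by_contra hbS
    exact hbC ⟨⟨hb, hbx⟩, hbS⟩
  · exact main S hS hS1 (fun a ha b hb hbx hbC => hSadj a ha b ⟨⟨hb, hbx⟩, hbC⟩)
      fun k hk h => h1 ⟨k, hk, h⟩

/-- The vertex `y'` is outside `C`, because its neighbour `y` is neither `x` nor in `C`. An edge `x'
y'` would thus leave `C` at a vertex other than `x`. -/
theorem IsPendantPart.not_adj_of_isPendantPart {x y : V} {C D : Set V}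
    (hC : IsPendantPart G X x C) (hD : IsPendantPart G X y D) (hxy : x ≠ y) (hy : y ∈ X)
    (hxD : x ∉ D) (hyC : y ∉ C) {x' y' : V} (hx' : x' ∈ C) (hy' : y' ∈ D) (hyy' : G.Adj y y') :
    ¬ G.Adj x' y' := by
  have h1 : y' ∉ C := fun h => hC.not_adj y' h y hy hxy.symm hyC hyy'.symm
  exact hC.not_adj x' hx' y' (hD.subset hy') (fun h => hxD (h ▸ hy')) h1

/-- The subgraph of `G` on all vertices whose edges are the edges of `G[X]`. -/
def onSet (G : SimpleGraph V) (X : Set V) : SimpleGraph V where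
  Adj a b := a ∈ X ∧ b ∈ X ∧ G.Adj a b
  symm := ⟨fun _ _ h => ⟨h.2.1, h.1, h.2.2.symm⟩⟩
  loopless := ⟨fun _ h => G.loopless.irrefl _ h.2.2⟩

theorem CutConnected.reachable (hX : CutConnected G X) {t z : V} (ht : t ∈ X) (hz : z ∈ X) :
    (onSet G X).Reachable t z := by
  by_contra hcon
  obtain ⟨u, hu, v, hv, huv⟩ := hX {w | w ∈ X ∧ (onSet G X).Reachable t w} (fun _ h => h.1)
    ⟨t, ht, .refl _⟩ ⟨z, hz, fun h => hcon h.2⟩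
  exact hv.2 ⟨hv.1, hu.2.trans (SimpleGraph.Adj.reachable (G := onSet G X) ⟨hu.1, hv.1, huv⟩)⟩

/-- Vertices outside `X` are isolated in `onSet G X`, and `dist` is `0` between unreachable
vertices, so they contribute nothing to `distSum`. -/
theorem onSet_dist_eq_zero {t z : V} (hz : z ∉ X) : (onSet G X).dist t z = 0 := by
  by_cases htz : t = z
  · subst htz; simp
  · refine SimpleGraph.dist_eq_zero_of_not_reachable fun h => ?_
    obtain ⟨p⟩ := h.symm
    cases p with
    | nil => exact htz rfl
    | cons h _ => exact hz h.1

theorem dist_le_dist_add_one_of_adj {H : SimpleGraph V} {t a b : V} (hab : H.Adj a b) :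
    H.dist t b ≤ H.dist t a + 1 := by
  by_cases h : H.Reachable t a
  · obtain ⟨p, hp⟩ := h.exists_walk_length_eq_dist
    rw [← hp, ← SimpleGraph.Walk.length_concat p hab]
    exact SimpleGraph.dist_le _
  · rw [SimpleGraph.dist_eq_zero_of_not_reachable fun h' => h (h'.trans hab.symm.reachable)]
    exact Nat.zero_le _

/-- A potential that grows by at most one along edges certifies lower bounds for the distances after
an exchange. -/
theorem le_dist_of_lipschitz {H : SimpleGraph V} (g : V → ℕ)
    (hg : ∀ a b, H.Adj a b → g b ≤ g a + 1) {t z : V} (ht : g t = 0) (h : H.Reachable t z) :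
    g z ≤ H.dist t z := by
  have key : ∀ {u v : V} (p : H.Walk u v), g v ≤ g u + p.length := by
    intro u v p
    induction p with
    | nil => simp
    | cons hab p ih =>
      have := hg _ _ hab
      rw [SimpleGraph.Walk.length_cons]
      omega
  obtain ⟨p, hp⟩ := h.exists_walk_length_eq_dist
  have := key p
  omega

/-- `X` is a connected dominating set in which `t₁, t₂, t₃` is a path that is attached to the rest
of `X` only at `t₃`. -/
structure IsTailed (G : SimpleGraph V) (t₁ t₂ t₃ : V) (X : Set V) : Prop where
  conn : CutConnected G X
  dom : ∀ v, ∃ x ∈ X, v = x ∨ G.Adj x v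
  mem₁ : t₁ ∈ X
  mem₂ : t₂ ∈ X
  mem₃ : t₃ ∈ X
  ne : t₁ ≠ t₃
  adj₁₂ : G.Adj t₁ t₂
  adj₂₃ : G.Adj t₂ t₃
  eq₁ : ∀ v ∈ X, G.Adj t₁ v → v = t₂
  eq₂ : ∀ v ∈ X, G.Adj t₂ v → v = t₁ ∨ v = t₃

/-- The sum of the distances from `t` in `G[X]`. -/
noncomputable def distSum [Fintype V] (G : SimpleGraph V) (t : V) (X : Set V) : ℕ :=
  ∑ v, (onSet G X).dist t v

/-- A tailed set of minimum size and, subject to this, of maximum sum of distances. -/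
structure IsOptimalTailed [Fintype V] (G : SimpleGraph V) (t₁ t₂ t₃ : V) (X : Set V) : Prop
    extends IsTailed G t₁ t₂ t₃ X where
  ncard_le : ∀ Y, IsTailed G t₁ t₂ t₃ Y → X.ncard ≤ Y.ncard
  distSum_le : ∀ Y, IsTailed G t₁ t₂ t₃ Y → Y.ncard = X.ncard → distSum G t₁ Y ≤ distSum G t₁ X

theorem IsTailed.exists_isOptimalTailed [Fintype V] {t₁ t₂ t₃ : V} (hX : IsTailed G t₁ t₂ t₃ X) :
    ∃ Y, IsOptimalTailed G t₁ t₂ t₃ Y := by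
  obtain ⟨Y, hY, hYmin⟩ := Set.exists_min_image {Y | IsTailed G t₁ t₂ t₃ Y} Set.ncard
    (Set.toFinite _) ⟨X, hX⟩
  obtain ⟨Z, hZ, hZmax⟩ := Set.exists_max_image
    {Z | IsTailed G t₁ t₂ t₃ Z ∧ Z.ncard = Y.ncard} (distSum G t₁)
    (Set.toFinite _) ⟨Y, hY, rfl⟩
  exact ⟨Z, hZ.1, fun W hW => hZ.2 ▸ hYmin W hW, fun W hW h => hZmax W ⟨hW, h.trans hZ.2⟩⟩

/-- `b` is a vertex outside `X` whose only neighbour in `X` is `x`. -/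
structure IsPrivate (G : SimpleGraph V) (X : Set V) (x b : V) : Prop where
  notMem : b ∉ X
  adj : G.Adj x b
  eq : ∀ v ∈ X, G.Adj v b → v = x

section

variable {t₁ t₂ t₃ : V}

theorem IsTailed.diff_of_dom (hX : IsTailed G t₁ t₂ t₃ X) {y : V} (h₁ : y ≠ t₁) (h₂ : y ≠ t₂)
    (h₃ : y ≠ t₃) (hconn : CutConnected G (X \ {y}))
    (hdom : ∀ v, ∃ x ∈ X \ {y}, v = x ∨ G.Adj x v) : IsTailed G t₁ t₂ t₃ (X \ {y}) where
  conn := hconn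
  dom := hdom
  mem₁ := ⟨hX.mem₁, h₁.symm⟩
  mem₂ := ⟨hX.mem₂, h₂.symm⟩
  mem₃ := ⟨hX.mem₃, h₃.symm⟩
  ne := hX.ne
  adj₁₂ := hX.adj₁₂
  adj₂₃ := hX.adj₂₃
  eq₁ v hv := hX.eq₁ v hv.1
  eq₂ v hv := hX.eq₂ v hv.1

/-- By minimality `X \ {y}` does not dominate. A vertex that it misses is not `y`, which has a
neighbour in `X`, so it is dominated by `y` alone. -/
theorem IsOptimalTailed.exists_isPrivate [Fintype V] (hX : IsOptimalTailed G t₁ t₂ t₃ X) {y : V}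
    (hy : y ∈ X) (h₁ : y ≠ t₁) (h₂ : y ≠ t₂) (h₃ : y ≠ t₃) (hconn : CutConnected G (X \ {y})) :
    ∃ b, IsPrivate G X y b := by
  have hnd : ¬ ∀ v, ∃ x ∈ X \ {y}, v = x ∨ G.Adj x v := by
    intro hdom
    have h4 := hX.ncard_le _ (hX.toIsTailed.diff_of_dom h₁ h₂ h₃ hconn hdom)
    have h5 := Set.ncard_sdiff_singleton_lt_of_mem hy (Set.toFinite X)
    omega
  push Not at hnd
  obtain ⟨b, hb⟩ := hnd
  have hbX : b ∈ X → b = y := fun h => by_contra fun h' => (hb b ⟨h, h'⟩).1 rfl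
  have hby : b ≠ y := by
    rintro rfl
    obtain ⟨z, hz, hbz⟩ := hX.conn.exists_adj hy hX.mem₁ h₁
    exact (hb z ⟨hz, hbz.ne'⟩).2 hbz.symm
  have heq : ∀ v ∈ X, G.Adj v b → v = y := fun v hv h =>
    by_contra fun h' => (hb v ⟨hv, h'⟩).2 h
  obtain ⟨z, hz, h⟩ := hX.dom b
  have hzb : G.Adj z b := h.resolve_left fun h => hby (hbX (h ▸ hz))
  exact ⟨b, fun h => hby (hbX h), heq z hz hzb ▸ hzb, heq⟩

/-- Exchanging `y` for a private neighbour `b` of `x` that is adjacent to all private neighbours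
of `y` is impossible in an optimal set if `x` is at least as far from `t₁` as `y`. -/
theorem IsOptimalTailed.exists_not_adj_of_dist_le [Fintype V] (hX : IsOptimalTailed G t₁ t₂ t₃ X)
    {x y b : V} (hx : x ∈ X) (hy : y ∈ X) (hxy : x ≠ y) (hx₁ : x ≠ t₁) (hx₂ : x ≠ t₂)
    (h₁ : y ≠ t₁) (h₂ : y ≠ t₂) (h₃ : y ≠ t₃) (hconn : CutConnected G (X \ {y}))
    (hb : IsPrivate G X x b) (hdist : (onSet G X).dist t₁ y ≤ (onSet G X).dist t₁ x) :
    ∃ e, IsPrivate G X y e ∧ ¬ G.Adj b e := by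
  classical
  by_contra! hcon
  have hby : b ≠ y := fun h => hb.notMem (h ▸ hy)
  have hbx : b ≠ x := fun h => hb.notMem (h ▸ hx)
  have hT : IsTailed G t₁ t₂ t₃ (insert b (X \ {y})) :=
    { conn := hconn.insert ⟨hx, hxy⟩ hb.adj.symm
      -- A vertex left undominated by the exchange would be a private neighbour of `y`, hence
      -- adjacent to `b`.
      dom := by
        intro v
        by_contra! hv
        have hvb : v ≠ b := (hv b (.inl rfl)).1
        have hvX : v ∈ X → v = y := fun h => by_contra fun h' => (hv v (.inr ⟨h, h'⟩)).1 rfl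
        have hvy : v ≠ y := by
          rintro rfl
          obtain ⟨z, hz, hvz⟩ := hX.conn.exists_adj hy hX.mem₁ h₁
          exact (hv z (.inr ⟨hz, hvz.ne'⟩)).2 hvz.symm
        have heq : ∀ z ∈ X, G.Adj z v → z = y := fun z hz h =>
          by_contra fun h' => (hv z (.inr ⟨hz, h'⟩)).2 h
        obtain ⟨z, hz, h⟩ := hX.dom v
        have hzv : G.Adj z v := h.resolve_left fun h => hvy (hvX (h ▸ hz))
        exact (hv b (.inl rfl)).2 (hcon v ⟨fun h => hvy (hvX h), heq z hz hzv ▸ hzv, heq⟩)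
      mem₁ := .inr ⟨hX.mem₁, h₁.symm⟩
      mem₂ := .inr ⟨hX.mem₂, h₂.symm⟩
      mem₃ := .inr ⟨hX.mem₃, h₃.symm⟩
      ne := hX.ne
      adj₁₂ := hX.adj₁₂
      adj₂₃ := hX.adj₂₃
      eq₁ := by
        rintro v (rfl | hv) hadj
        · exact absurd (hb.eq _ hX.mem₁ hadj).symm hx₁
        · exact hX.eq₁ v hv.1 hadj
      eq₂ := by
        rintro v (rfl | hv) hadj
        · exact absurd (hb.eq _ hX.mem₂ hadj).symm hx₂
        · exact hX.eq₂ v hv.1 hadj }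
  have hcard : (insert b (X \ {y})).ncard = X.ncard := by
    rw [Set.ncard_insert_of_notMem (fun h => hb.notMem h.1) (Set.toFinite _),
      Set.ncard_sdiff_singleton_add_one hy (Set.toFinite _)]
  have hsum := hX.distSum_le _ hT hcard
  let δ : V → ℕ := fun v => (onSet G X).dist t₁ v
  -- Deleting `y` shortens no distance, and `b` hangs on `x` alone, so `g` bounds the new distances
  -- from below. The distance sum therefore grows by at least `δ x + 1 - δ y > 0`.
  let g : V → ℕ := fun v => if v = b then δ x + 1 else if v = y then 0 else δ v
  have hgx : g x = δ x := by simp [g, hbx.symm, hxy]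
  have hgb : g b = δ x + 1 := by simp [g]
  have hgo : ∀ v ∈ X \ {y}, g v = δ v := fun v hv => by
    have h4 : v ≠ b := fun h => hb.notMem (h ▸ hv.1)
    have h5 : v ≠ y := hv.2
    simp [g, h4, h5]
  have hglip : ∀ u v, (onSet G (insert b (X \ {y}))).Adj u v → g v ≤ g u + 1 := by
    rintro u v ⟨rfl | hu, rfl | hv, huv⟩
    · omega
    · have := hb.eq v hv.1 huv.symm
      subst this
      omega
    · have := hb.eq u hu.1 huv
      subst this
      omega
    · rw [hgo u hu, hgo v hv]
      exact dist_le_dist_add_one_of_adj (H := onSet G X) ⟨hu.1, hv.1, huv⟩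
  have hgt : g t₁ = 0 := by
    rw [hgo t₁ ⟨hX.mem₁, h₁.symm⟩]
    simp [δ]
  have hgle : ∀ v, g v ≤ (onSet G (insert b (X \ {y}))).dist t₁ v := by
    intro v
    by_cases hv : v ∈ insert b (X \ {y})
    · exact le_dist_of_lipschitz g hglip hgt (hT.conn.reachable hT.mem₁ hv)
    · have h4 : v ≠ b := fun h => hv (.inl h)
      have h5 : g v = 0 := by
        simp only [g, h4, if_false]
        split_ifs with h6
        · rfl
        · exact onSet_dist_eq_zero fun h7 => hv (.inr ⟨h7, h6⟩)
      omega
  have hsum2 : ∑ v, g v ≤ distSum G t₁ (insert b (X \ {y})) := Finset.sum_le_sum fun v _ => hgle v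
  have hδb : δ b = 0 := onSet_dist_eq_zero hb.notMem
  have hpoint : ∀ v, g v + (if v = y then δ y else 0) = δ v + (if v = b then δ x + 1 else 0) := by
    intro v
    by_cases h4 : v = b
    · subst h4
      simp [hgb, hby, hδb]
    · by_cases h5 : v = y
      · subst h5
        simp [g, h4]
      · simp [g, h4, h5]
  have hsum3 : ∑ v, g v + δ y = ∑ v, δ v + (δ x + 1) := by
    have := Finset.sum_congr rfl fun v (_ : v ∈ Finset.univ) => hpoint v
    simpa [Finset.sum_add_distrib] using this
  have hsum4 : distSum G t₁ X = ∑ v, δ v := rfl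
  have hdist' : δ y ≤ δ x := hdist
  omega

/-- Deleting `t₂` or `t₃` separates `t₁` from `y`. So a non-cut vertex with such a `y` is neither of
them, and minimality applies to it. -/
theorem IsTailed.not_cutConnected_diff (hX : IsTailed G t₁ t₂ t₃ X) {x y : V} (hx : x = t₂ ∨ x = t₃)
    (hy : y ∈ X) (hxy : x ≠ y) (hadj : ¬ G.Adj x y) (hy₁ : y ≠ t₁) :
    ¬ CutConnected G (X \ {x}) := by
  intro hconn
  rcases hx with rfl | rfl
  · obtain ⟨u, hu, v, hv, huv⟩ := hconn {t₁} (by simpa using ⟨hX.mem₁, hX.adj₁₂.ne⟩) ⟨t₁, rfl⟩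
      ⟨y, ⟨hy, hxy.symm⟩, hy₁⟩
    obtain rfl : u = t₁ := hu
    exact hv.1.2 (hX.eq₁ v hv.1.1 huv)
  · have hy₂ : y ≠ t₂ := fun h => hadj (h ▸ hX.adj₂₃.symm)
    obtain ⟨u, hu, v, hv, huv⟩ := hconn {t₁, t₂}
      (by
        rintro z (rfl | rfl)
        · exact ⟨hX.mem₁, hX.ne⟩
        · exact ⟨hX.mem₂, hX.adj₂₃.ne⟩)
      ⟨t₁, .inl rfl⟩ ⟨y, ⟨hy, hxy.symm⟩, by simp [hy₁, hy₂]⟩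
    rcases hu with rfl | rfl
    · exact hv.2 (.inr (hX.eq₁ v hv.1.1 huv))
    · rcases hX.eq₂ v hv.1.1 huv with h | h
      · exact hv.2 (.inl h)
      · exact hv.1.2 h

/-- Nonadjacent vertices `x`, `y` of an optimal set can be extended by nonadjacent vertices that
have no other neighbours in given connected sets. -/
theorem IsOptimalTailed.exists_extensions [Fintype V] (hX : IsOptimalTailed G t₁ t₂ t₃ X) {x y : V}
    (hx : x ∈ X) (hy : y ∈ X) (hxy : x ≠ y) (hadj : ¬ G.Adj x y) (hx₁ : x ≠ t₁) (hy₁ : y ≠ t₁)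
    {K L : Set V} (hK : CutConnected G K) (hL : CutConnected G L) (hKX : K ⊆ X) (hLX : L ⊆ X)
    (hxK : x ∉ K) (hyL : y ∉ L) (hyK : y ∈ K) (hxL : x ∈ L) :
    ∃ x' y', G.Adj x x' ∧ G.Adj y y' ∧ ¬ G.Adj x' y' ∧ (∀ k ∈ K, ¬ G.Adj k x') ∧
      ∀ k ∈ L, ¬ G.Adj k y' := by
  have part : ∀ {z : V} {M C : Set V}, IsPendantPart G X z C → M ⊆ X → z ∉ M →
      (∀ k ∈ M, k ∉ C) → ∀ z' ∈ C, ∀ k ∈ M, ¬ G.Adj k z' := fun hC hMX hzM hMC z' hz' k hk h =>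
    hC.not_adj z' hz' k (hMX hk) (fun h' => hzM (h' ▸ hk)) (hMC k hk) h.symm
  have priv : ∀ {z : V} {M : Set V}, M ⊆ X → z ∉ M → ∀ b, IsPrivate G X z b →
      ∀ k ∈ M, ¬ G.Adj k b := fun hMX hzM b hb k hk h => hzM (hb.eq k (hMX hk) h ▸ hk)
  -- A non-cut vertex is extended by a private neighbour, a cut vertex into a pendant part.
  by_cases hcx : CutConnected G (X \ {x})
  · have hx₂ : x ≠ t₂ := fun h =>
      hX.not_cutConnected_diff (.inl h) hy hxy hadj hy₁ hcx
    have hx₃ : x ≠ t₃ := fun h =>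
      hX.not_cutConnected_diff (.inr h) hy hxy hadj hy₁ hcx
    obtain ⟨b, hb⟩ := hX.exists_isPrivate hx hx₁ hx₂ hx₃ hcx
    by_cases hcy : CutConnected G (X \ {y})
    · have hy₂ : y ≠ t₂ := fun h =>
        hX.not_cutConnected_diff (.inl h) hx hxy.symm (fun h => hadj h.symm) hx₁ hcy
      have hy₃ : y ≠ t₃ := fun h =>
        hX.not_cutConnected_diff (.inr h) hx hxy.symm (fun h => hadj h.symm) hx₁ hcy
      obtain ⟨e, he⟩ := hX.exists_isPrivate hy hy₁ hy₂ hy₃ hcy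
      -- The vertex farther from `t₁` keeps its private neighbour; that of the nearer one is chosen
      -- to avoid it.
      rcases le_total ((onSet G X).dist t₁ y) ((onSet G X).dist t₁ x) with h | h
      · obtain ⟨e, he, hbe⟩ :=
          hX.exists_not_adj_of_dist_le hx hy hxy hx₁ hx₂ hy₁ hy₂ hy₃ hcy hb h
        exact ⟨b, e, hb.adj, he.adj, hbe, priv hKX hxK b hb, priv hLX hyL e he⟩
      · obtain ⟨b, hb, hbe⟩ :=
          hX.exists_not_adj_of_dist_le hy hx hxy.symm hy₁ hy₂ hx₁ hx₂ hx₃ hcx he h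
        exact ⟨b, e, hb.adj, he.adj, fun h => hbe h.symm, priv hKX hxK b hb, priv hLX hyL e he⟩
    · obtain ⟨D, hD, hLD, y', hy', hyy'⟩ := hX.conn.exists_isPendantPart hy hcy hLX hyL hL
      refine ⟨b, y', hb.adj, hyy', fun h => ?_, priv hKX hxK b hb, part hD hLX hyL hLD y' hy'⟩
      exact hLD x hxL (hb.eq y' (hD.subset hy') h.symm ▸ hy')
  · obtain ⟨C, hC, hKC, x', hx', hxx'⟩ := hX.conn.exists_isPendantPart hx hcx hKX hxK hK
    by_cases hcy : CutConnected G (X \ {y})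
    · have hy₂ : y ≠ t₂ := fun h =>
        hX.not_cutConnected_diff (.inl h) hx hxy.symm (fun h => hadj h.symm) hx₁ hcy
      have hy₃ : y ≠ t₃ := fun h =>
        hX.not_cutConnected_diff (.inr h) hx hxy.symm (fun h => hadj h.symm) hx₁ hcy
      obtain ⟨e, he⟩ := hX.exists_isPrivate hy hy₁ hy₂ hy₃ hcy
      refine ⟨x', e, hxx', he.adj, fun h => ?_, part hC hKX hxK hKC x' hx', priv hLX hyL e he⟩
      exact hKC y hyK (he.eq x' (hC.subset hx') h ▸ hx')
    · obtain ⟨D, hD, hLD, y', hy', hyy'⟩ := hX.conn.exists_isPendantPart hy hcy hLX hyL hL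
      exact ⟨x', y', hxx', hyy', hC.not_adj_of_isPendantPart hD hxy hy (hLD x hxL) (hKC y hyK)
        hx' hy' hyy', part hC hKX hxK hKC x' hx', part hD hLX hyL hLD y' hy'⟩

end

end

/-! ### Extending claws and nets -/

section

variable {V : Type*} {G : SimpleGraph V} {X : Set V}

theorem InducedFree.false_of_extended_claw (h : InducedFree (subdividedClaw 2) G)
    {c p x y p' x' y' : V} (hcp : G.Adj c p) (hcx : G.Adj c x) (hcy : G.Adj c y)
    (hpp' : G.Adj p p') (hxx' : G.Adj x x') (hyy' : G.Adj y y') (hpx : ¬ G.Adj p x)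
    (hpy : ¬ G.Adj p y) (hxy : ¬ G.Adj x y)
    (hp' : ∀ k ∈ ({c, x, y} : Set V), ¬ G.Adj k p')
    (hx' : ∀ k ∈ ({c, p, y} : Set V), ¬ G.Adj k x')
    (hy' : ∀ k ∈ ({c, p, x} : Set V), ¬ G.Adj k y')
    (h₁ : ¬ G.Adj p' x') (h₂ : ¬ G.Adj p' y') (h₃ : ¬ G.Adj x' y') : False := by
  have hs : ∀ {a b : V}, ¬ G.Adj a b → ¬ G.Adj b a := fun h h' => h h'.symm
  simp only [Set.mem_insert_iff, Set.mem_singleton_iff, forall_eq_or_imp, forall_eq] at hp' hx' hy'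
  refine h.false_of_subdividedClaw c ![p, x, y] ![p', x', y'] ?_ ?_ ?_ ?_ ?_ ?_ <;>
    simp [Fin.forall_fin_succ, *]

theorem InducedFree.false_of_extended_net (h : InducedFree (subdividedNet 2) G)
    {a b c p x y p' x' y' : V} (hab : G.Adj a b) (hac : G.Adj a c) (hbc : G.Adj b c)
    (hap : G.Adj a p) (hbx : G.Adj b x) (hcy : G.Adj c y) (hpp' : G.Adj p p')
    (hxx' : G.Adj x x') (hyy' : G.Adj y y')
    (hax : ¬ G.Adj a x) (hay : ¬ G.Adj a y) (hbp : ¬ G.Adj b p) (hby : ¬ G.Adj b y)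
    (hcp : ¬ G.Adj c p) (hcx : ¬ G.Adj c x) (hpx : ¬ G.Adj p x) (hpy : ¬ G.Adj p y)
    (hxy : ¬ G.Adj x y)
    (hp' : ∀ k ∈ ({a, b, c, x, y} : Set V), ¬ G.Adj k p')
    (hx' : ∀ k ∈ ({a, b, c, p, y} : Set V), ¬ G.Adj k x')
    (hy' : ∀ k ∈ ({a, b, c, p, x} : Set V), ¬ G.Adj k y')
    (h₁ : ¬ G.Adj p' x') (h₂ : ¬ G.Adj p' y') (h₃ : ¬ G.Adj x' y') : False := by
  have hs : ∀ {a b : V}, ¬ G.Adj a b → ¬ G.Adj b a := fun h h' => h h'.symm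
  simp only [Set.mem_insert_iff, Set.mem_singleton_iff, forall_eq_or_imp, forall_eq] at hp' hx' hy'
  refine h.false_of_subdividedNet ![a, b, c] ![p, x, y] ![p', x', y'] ?_ ?_ ?_ ?_ ?_ ?_ ?_ ?_ <;>
    simp [Fin.forall_fin_succ, hab.symm, hac.symm, hbc.symm, *]

/-- It keeps `t₁` from being a leaf of a claw or net, whose attaching vertex would have two further
neighbours. -/
theorem IsTailed.false_of_adj_of_adj {t₁ t₂ t₃ : V} (hX : IsTailed G t₁ t₂ t₃ X) {c u v : V}
    (hc : c ∈ X) (hu : u ∈ X) (hv : v ∈ X) (htc : G.Adj t₁ c) (hcu : G.Adj c u) (hcv : G.Adj c v)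
    (hu₁ : u ≠ t₁) (hv₁ : v ≠ t₁) (huv : u ≠ v) : False := by
  obtain rfl := hX.eq₁ c hc htc
  exact huv (((hX.eq₂ u hu hcu).resolve_left hu₁).trans ((hX.eq₂ v hv hcv).resolve_left hv₁).symm)

/-- The anchor `q` extends the leaf `p`, so only `x` and `y` need `exists_extensions`. The sets `K`
and `L` contain `q` as well, which keeps the new vertices nonadjacent to it. -/
theorem IsOptimalTailed.rootedClawNetFree [Fintype V] {t₁ t₂ t₃ : V}
    (hX : IsOptimalTailed G t₁ t₂ t₃ X) (hS : InducedFree (subdividedClaw 2) G)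
    (hT : InducedFree (subdividedNet 2) G) : RootedClawNetFree G X t₁ where
  triple x hx y hy z hz hrx hry _ hxy _ _ _ _ _ :=
    hxy ((hX.eq₁ x hx hrx).trans (hX.eq₁ y hy hry).symm)
  claw c hc p hp x hx y hy hcp hcx hcy hpx hpy hxy hpx' hpy' hxy' := by
    rintro (rfl | ⟨q, hq, hpq, hqc, hqc', hqx, hqy⟩)
    · exact hX.false_of_adj_of_adj hc hx hy hcp.symm hcx hcy hpx'.symm hpy'.symm hxy'
    have hx₁ : x ≠ t₁ := by
      rintro rfl
      exact hX.false_of_adj_of_adj hc hp hy hcx.symm hcp hcy hpx' hxy'.symm hpy'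
    have hy₁ : y ≠ t₁ := by
      rintro rfl
      exact hX.false_of_adj_of_adj hc hp hx hcy.symm hcp hcx hpy' hxy' hpx'
    have hqx' : q ≠ x := fun h => hpx (h ▸ hpq)
    have hqy' : q ≠ y := fun h => hpy (h ▸ hpq)
    have hbase : CutConnected G {c, p, q} :=
      ((CutConnected.singleton q).insert rfl hpq).insert (.inl rfl) hcp
    obtain ⟨x', y', hxx', hyy', hx'y', hKx', hLy'⟩ := hX.exists_extensions hx hy hxy' hxy hx₁ hy₁
      (K := {y, c, p, q}) (L := {x, c, p, q})
      (hbase.insert (.inl rfl) hcy.symm) (hbase.insert (.inl rfl) hcx.symm)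
      (by simp [Set.insert_subset_iff, *]) (by simp [Set.insert_subset_iff, *])
      (by simp [hxy', hcx.ne', hpx'.symm, hqx'.symm]) (by simp [hxy'.symm, hcy.ne', hpy'.symm, hqy'.symm])
      (.inl rfl) (.inl rfl)
    simp only [Set.mem_insert_iff, Set.mem_singleton_iff, forall_eq_or_imp, forall_eq] at hKx' hLy'
    have hs : ∀ {a b : V}, ¬ G.Adj a b → ¬ G.Adj b a := fun h h' => h h'.symm
    refine hS.false_of_extended_claw hcp hcx hcy hpq hxx' hyy' hpx hpy hxy ?_ ?_ ?_
      hKx'.2.2.2 hLy'.2.2.2 hx'y' <;> simp [*]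
  net a ha b hb c hc p hp x hx y hy hab hac hbc hap hbx hcy hax hay hbp hby hcp hcx hpx hpy hxy := by
    have hpb : p ≠ b := fun h => hcp (h ▸ hbc.symm)
    have hpc : p ≠ c := fun h => hbp (h ▸ hbc)
    have hxa : x ≠ a := fun h => hcx (h ▸ hac.symm)
    have hxc : x ≠ c := fun h => hax (h ▸ hac)
    have hya : y ≠ a := fun h => hby (h ▸ hab.symm)
    have hyb : y ≠ b := fun h => hay (h ▸ hab)
    have hpx' : p ≠ x := fun h => hbp (h ▸ hbx)
    have hpy' : p ≠ y := fun h => hcp (h ▸ hcy)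
    have hxy' : x ≠ y := fun h => hby (h ▸ hbx)
    rintro (rfl | ⟨q, hq, hpq, hqa, hqa', hqb, hqc, hqx, hqy⟩)
    · exact hX.false_of_adj_of_adj ha hb hc hap.symm hab hac hpb.symm hpc.symm hbc.ne
    have hx₁ : x ≠ t₁ := by
      rintro rfl
      exact hX.false_of_adj_of_adj hb ha hc hbx.symm hab.symm hbc hxa.symm hxc.symm hac.ne
    have hy₁ : y ≠ t₁ := by
      rintro rfl
      exact hX.false_of_adj_of_adj hc ha hb hcy.symm hac.symm hbc.symm hya.symm hyb.symm hab.ne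
    have hqx' : q ≠ x := fun h => hpx (h ▸ hpq)
    have hqy' : q ≠ y := fun h => hpy (h ▸ hpq)
    have hbase : CutConnected G {b, c, a, p, q} :=
      ((((CutConnected.singleton q).insert rfl hpq).insert (.inl rfl) hap).insert (.inl rfl)
        hac.symm).insert (.inl rfl) hbc
    obtain ⟨x', y', hxx', hyy', hx'y', hKx', hLy'⟩ := hX.exists_extensions hx hy hxy' hxy hx₁ hy₁
      (K := {y, b, c, a, p, q}) (L := {x, b, c, a, p, q})
      (hbase.insert (.inr (.inl rfl)) hcy.symm) (hbase.insert (.inl rfl) hbx.symm)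
      (by simp [Set.insert_subset_iff, *]) (by simp [Set.insert_subset_iff, *])
      (by simp [hxy', hbx.ne', hxc, hxa, hpx'.symm, hqx'.symm])
      (by simp [hxy'.symm, hcy.ne', hyb, hya, hpy'.symm, hqy'.symm]) (.inl rfl) (.inl rfl)
    simp only [Set.mem_insert_iff, Set.mem_singleton_iff, forall_eq_or_imp, forall_eq] at hKx' hLy'
    have hs : ∀ {a b : V}, ¬ G.Adj a b → ¬ G.Adj b a := fun h h' => h h'.symm
    refine hT.false_of_extended_net hab hac hbc hap hbx hcy hpq hxx' hyy' hax hay hbp hby hcp hcx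
      hpx hpy hxy ?_ ?_ ?_ hKx'.2.2.2.2.2 hLy'.2.2.2.2.2 hx'y' <;> simp [*]

theorem IsTailed.exists_dominating_list [Fintype V] {t₁ t₂ t₃ : V} (hX : IsTailed G t₁ t₂ t₃ X)
    (hS : InducedFree (subdividedClaw 2) G) (hT : InducedFree (subdividedNet 2) G) :
    ∃ l : List V, l ≠ [] ∧ l.Nodup ∧ l.IsChain G.Adj ∧ ∀ v, ∃ x ∈ l, v = x ∨ G.Adj x v := by
  obtain ⟨Y, hY⟩ := hX.exists_isOptimalTailed
  obtain ⟨d, ⟨c, hc, hc0⟩, hdmax⟩ : ∃ d, (∃ c, IsInducedPath G Y c d ∧ c 0 = t₁) ∧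
      ∀ d', (∃ c, IsInducedPath G Y c d' ∧ c 0 = t₁) → d' ≤ d := by
    refine Set.exists_max_image {d | ∃ c, IsInducedPath G Y c d ∧ c 0 = t₁} id
      ((Set.finite_lt_nat (Nat.card V)).subset fun d ⟨c, hc, _⟩ => hc.lt_card)
      ⟨0, fun _ => t₁, ⟨fun _ _ => hY.mem₁, fun i hi j hj _ => by omega, fun i hi j hj => ?_⟩, rfl⟩
    simp only [SimpleGraph.irrefl, false_iff]
    omega
  have hmax : ∀ c', IsInducedPath G Y c' (d + 1) → c' 0 ≠ c 0 := fun c' hc' h => by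
    have := hdmax (d + 1) ⟨c', hc', h.trans hc0⟩
    omega
  subst hc0
  -- The root condition is vacuous: the only neighbour of `t₁` in `Y` lies on the path if `1 ≤ d`,
  -- and would extend it if `d = 0`.
  obtain ⟨l, hne, hnd, hch, hmem⟩ := hc.exists_hamiltonian_list hY.conn
    (hY.rootedClawNetFree hS hT) hmax fun w hw w' _ hcw h0w _ => by
      exfalso
      rcases Nat.eq_zero_or_pos d with rfl | hd
      · refine hmax _ (hc.extend hw hcw fun i hi => ?_) (by simp)
        obtain rfl : i = 0 := by omega
        simpa using h0w
      · refine hcw 1 hd ((hY.eq₁ _ (hc.mem 1 hd) ?_).trans (hY.eq₁ w hw h0w).symm)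
        exact (hc.adj_iff 0 (by omega) 1 hd).2 (by omega)
  refine ⟨l, hne, hnd, hch, fun v => ?_⟩
  obtain ⟨x, hx, h⟩ := hY.dom v
  exact ⟨x, (hmem x).2 hx, h⟩

/-! ### Graphs with many cut vertices -/

/-- If every vertex of `X` is a cut vertex of `G`, then the claws in `G[X]` extend to copies of
the subdivided claw in `G`. -/
theorem InducedFree.false_of_claw_of_cut (hS : InducedFree (subdividedClaw 2) G)
    (hG : CutConnected G Set.univ) (hcut : ∀ v ∈ X, ¬ CutConnected G (Set.univ \ {v}))
    {c p x y : V} (hp : p ∈ X) (hx : x ∈ X) (hy : y ∈ X) (hcp : G.Adj c p) (hcx : G.Adj c x)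
    (hcy : G.Adj c y) (hpx : ¬ G.Adj p x) (hpy : ¬ G.Adj p y) (hxy : ¬ G.Adj x y)
    (hpx' : p ≠ x) (hpy' : p ≠ y) (hxy' : x ≠ y) : False := by
  have hext : ∀ z ∈ X, ∀ u v, z ≠ c → z ≠ u → z ≠ v → G.Adj u c → G.Adj v c →
      ∃ C, IsPendantPart G Set.univ z C ∧ (∀ k ∈ ({c, u, v} : Set V), k ∉ C) ∧
        (∃ z' ∈ C, G.Adj z z') ∧ ∀ z' ∈ C, ∀ k ∈ ({c, u, v} : Set V), ¬ G.Adj k z' := by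
    intro z hz u v hzc hzu hzv huc hvc
    obtain ⟨C, hC, hKC, hC'⟩ := hG.exists_isPendantPart (Set.mem_univ z) (hcut z hz)
      (K := {u, v, c}) (Set.subset_univ _) (by simp [*])
      (((CutConnected.singleton c).insert rfl hvc).insert (.inr rfl) huc)
    rw [show ({u, v, c} : Set V) = {c, u, v} by ext; simp; tauto] at hKC
    refine ⟨C, hC, hKC, hC', fun z' hz' k hk h => ?_⟩
    refine hC.not_adj z' hz' k (Set.mem_univ k) ?_ (hKC k hk) h.symm
    rcases hk with rfl | rfl | rfl
    · exact hzc.symm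
    · exact hzu.symm
    · exact hzv.symm
  obtain ⟨P, hP, hKP, ⟨p', hp', hpp'⟩, hP'⟩ := hext p hp x y hcp.ne' hpx' hpy' hcx.symm hcy.symm
  obtain ⟨C, hC, hKC, ⟨x', hx', hxx'⟩, hC'⟩ :=
    hext x hx p y hcx.ne' hpx'.symm hxy' hcp.symm hcy.symm
  obtain ⟨D, hD, hKD, ⟨y', hy', hyy'⟩, hD'⟩ :=
    hext y hy p x hcy.ne' hpy'.symm hxy'.symm hcp.symm hcx.symm
  exact hS.false_of_extended_claw hcp hcx hcy hpp' hxx' hyy' hpx hpy hxy (hP' p' hp') (hC' x' hx')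
    (hD' y' hy')
    (hP.not_adj_of_isPendantPart hC hpx' (Set.mem_univ _) (hKC _ (by simp)) (hKP _ (by simp))
      hp' hx' hxx')
    (hP.not_adj_of_isPendantPart hD hpy' (Set.mem_univ _) (hKD _ (by simp)) (hKP _ (by simp))
      hp' hy' hyy')
    (hC.not_adj_of_isPendantPart hD hxy' (Set.mem_univ _) (hKD _ (by simp)) (hKC _ (by simp))
      hx' hy' hyy')

/-- If every vertex of `X` is a cut vertex of `G`, then the nets in `G[X]` extend to copies of
the subdivided net in `G`. -/
theorem InducedFree.false_of_net_of_cut (hT : InducedFree (subdividedNet 2) G)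
    (hG : CutConnected G Set.univ) (hcut : ∀ v ∈ X, ¬ CutConnected G (Set.univ \ {v}))
    {a b c p x y : V} (hp : p ∈ X) (hx : x ∈ X) (hy : y ∈ X) (hab : G.Adj a b) (hac : G.Adj a c)
    (hbc : G.Adj b c) (hap : G.Adj a p) (hbx : G.Adj b x) (hcy : G.Adj c y)
    (hax : ¬ G.Adj a x) (hay : ¬ G.Adj a y) (hbp : ¬ G.Adj b p) (hby : ¬ G.Adj b y)
    (hcp : ¬ G.Adj c p) (hcx : ¬ G.Adj c x) (hpx : ¬ G.Adj p x) (hpy : ¬ G.Adj p y)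
    (hxy : ¬ G.Adj x y) : False := by
  have hpb : p ≠ b := fun h => hcp (h ▸ hbc.symm)
  have hpc : p ≠ c := fun h => hbp (h ▸ hbc)
  have hxa : x ≠ a := fun h => hcx (h ▸ hac.symm)
  have hxc : x ≠ c := fun h => hax (h ▸ hac)
  have hya : y ≠ a := fun h => hby (h ▸ hab.symm)
  have hyb : y ≠ b := fun h => hay (h ▸ hab)
  have hpx' : p ≠ x := fun h => hbp (h ▸ hbx)
  have hpy' : p ≠ y := fun h => hcp (h ▸ hcy)
  have hxy' : x ≠ y := fun h => hby (h ▸ hbx)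
  have hbase : CutConnected G {a, b, c} :=
    ((CutConnected.singleton c).insert rfl hbc).insert (.inl rfl) hab
  have hext : ∀ z ∈ X, ∀ u v, z ≠ a → z ≠ b → z ≠ c → z ≠ u → z ≠ v →
      (∃ w ∈ ({a, b, c} : Set V), G.Adj u w) → (∃ w ∈ ({a, b, c} : Set V), G.Adj v w) →
      ∃ C, IsPendantPart G Set.univ z C ∧ (∀ k ∈ ({a, b, c, u, v} : Set V), k ∉ C) ∧
        (∃ z' ∈ C, G.Adj z z') ∧ ∀ z' ∈ C, ∀ k ∈ ({a, b, c, u, v} : Set V), ¬ G.Adj k z' := by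
    rintro z hz u v hza hzb hzc hzu hzv ⟨w₁, hw₁, hu⟩ ⟨w₂, hw₂, hv⟩
    obtain ⟨C, hC, hKC, hC'⟩ := hG.exists_isPendantPart (Set.mem_univ z) (hcut z hz)
      (K := {u, v, a, b, c}) (Set.subset_univ _) (by simp [*])
      ((hbase.insert hw₂ hv).insert (.inr hw₁) hu)
    rw [show ({u, v, a, b, c} : Set V) = {a, b, c, u, v} by ext; simp; tauto] at hKC
    refine ⟨C, hC, hKC, hC', fun z' hz' k hk h => ?_⟩
    refine hC.not_adj z' hz' k (Set.mem_univ k) ?_ (hKC k hk) h.symm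
    rcases hk with rfl | rfl | rfl | rfl | rfl
    · exact hza.symm
    · exact hzb.symm
    · exact hzc.symm
    · exact hzu.symm
    · exact hzv.symm
  have hp₀ : ∃ w ∈ ({a, b, c} : Set V), G.Adj p w := ⟨a, by simp, hap.symm⟩
  have hx₀ : ∃ w ∈ ({a, b, c} : Set V), G.Adj x w := ⟨b, by simp, hbx.symm⟩
  have hy₀ : ∃ w ∈ ({a, b, c} : Set V), G.Adj y w := ⟨c, by simp, hcy.symm⟩
  obtain ⟨P, hP, hKP, ⟨p', hp', hpp'⟩, hP'⟩ := hext p hp x y hap.ne' hpb hpc hpx' hpy' hx₀ hy₀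
  obtain ⟨C, hC, hKC, ⟨x', hx', hxx'⟩, hC'⟩ :=
    hext x hx p y hxa hbx.ne' hxc hpx'.symm hxy' hp₀ hy₀
  obtain ⟨D, hD, hKD, ⟨y', hy', hyy'⟩, hD'⟩ :=
    hext y hy p x hya hyb hcy.ne' hpy'.symm hxy'.symm hp₀ hx₀
  exact hT.false_of_extended_net hab hac hbc hap hbx hcy hpp' hxx' hyy' hax hay hbp hby hcp hcx
    hpx hpy hxy (hP' p' hp') (hC' x' hx') (hD' y' hy')
    (hP.not_adj_of_isPendantPart hC hpx' (Set.mem_univ _) (hKC _ (by simp)) (hKP _ (by simp))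
      hp' hx' hxx')
    (hP.not_adj_of_isPendantPart hD hpy' (Set.mem_univ _) (hKD _ (by simp)) (hKP _ (by simp))
      hp' hy' hyy')
    (hC.not_adj_of_isPendantPart hD hxy' (Set.mem_univ _) (hKD _ (by simp)) (hKC _ (by simp))
      hx' hy' hyy')

/-- If every vertex of a connected set `X` is a cut vertex of `G`, then `X` has a Hamiltonian
path. -/
theorem CutConnected.exists_hamiltonian_list_of_cut [Finite V] (hX : CutConnected G X)
    (hne : X.Nonempty) (hG : CutConnected G Set.univ)
    (hcut : ∀ v ∈ X, ¬ CutConnected G (Set.univ \ {v}))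
    (hS : InducedFree (subdividedClaw 2) G) (hT : InducedFree (subdividedNet 2) G) :
    ∃ l : List V, l ≠ [] ∧ l.Nodup ∧ l.IsChain G.Adj ∧ ∀ v, v ∈ l ↔ v ∈ X := by
  obtain ⟨x₀, hx₀⟩ := hne
  obtain ⟨d, ⟨c, hc⟩, hdmax⟩ : ∃ d, (∃ c, IsInducedPath G X c d) ∧
      ∀ d', (∃ c, IsInducedPath G X c d') → d' ≤ d := by
    refine Set.exists_max_image {d | ∃ c, IsInducedPath G X c d} id
      ((Set.finite_lt_nat (Nat.card V)).subset fun d ⟨c, hc⟩ => hc.lt_card)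
      ⟨0, fun _ => x₀, fun _ _ => hx₀, fun i hi j hj _ => by omega, fun i hi j hj => ?_⟩
    simp only [SimpleGraph.irrefl, false_iff]
    omega
  have hmax : ∀ c', ¬ IsInducedPath G X c' (d + 1) := fun c' hc' => by
    have := hdmax (d + 1) ⟨c', hc'⟩
    omega
  refine hc.exists_hamiltonian_list hX ⟨?_, ?_, ?_⟩ (fun c' hc' => absurd hc' (hmax c')) ?_
  · intro c hc p hp x hx y hy hcp hcx hcy hpx hpy hxy hpx' hpy' hxy' _
    exact hS.false_of_claw_of_cut hG hcut hp hx hy hcp hcx hcy hpx hpy hxy hpx' hpy' hxy'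
  · intro a ha b hb c hc p hp x hx y hy hab hac hbc hap hbx hcy hax hay hbp hby hcp hcx hpx hpy hxy _
    exact hT.false_of_net_of_cut hG hcut hp hx hy hab hac hbc hap hbx hcy hax hay hbp hby hcp hcx
      hpx hpy hxy
  · intro x hx y hy z hz hrx hry hrz hxy' hxz' hyz' hxy hxz hyz
    exact hS.false_of_claw_of_cut hG hcut hx hy hz hrx hry hrz hxy hxz hyz hxy' hxz' hyz'
  · intro w hw w' hw' hcw h0w hww'
    by_contra! hund
    have hfar : ∀ k ≤ d, 2 ≤ k → ¬ G.Adj (c k) w := fun k hk h2 hkw =>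
      hS.false_of_claw_of_cut hG hcut (hc.mem 0 (by omega)) (hc.mem k hk) hw' h0w.symm hkw.symm hww'
        (fun h => by have := (hc.adj_iff 0 (by omega) k hk).1 h; omega) (hund 0 (by omega)).2
        (hund k hk).2 (fun h => by have := hc.inj 0 (by omega) k hk h; omega)
        (hund 0 (by omega)).1 (hund k hk).1
    -- If `w` sees `c 0` and `c 1`, then `w', w, c 1, …, c d` is a longer induced path; if it sees
    -- only `c 0`, then `w, c 0, …, c d` is. The path is reversed because `extend` appends at the
    -- end.
    by_cases h1 : 1 ≤ d ∧ G.Adj (c 1) w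
    · obtain ⟨hd, h1⟩ := h1
      have h2 := (hc.reverse.mono_length (Nat.sub_le d 1)).extend hw
        (fun i _ => hcw _ (by omega)) fun i hi => by
          constructor
          · intro h
            by_contra hid
            exact hfar (d - i) (by omega) (by omega) h
          · rintro rfl
            rwa [Nat.sub_sub_self hd]
      refine hmax _ ((Nat.sub_add_cancel hd ▸ h2).extend hw' (fun i hi => ?_) fun i hi => ?_)
      · split_ifs
        · exact (hund _ (by omega)).1
        · exact hww'.ne
      · split_ifs
        · simp only [(hund (d - i) (by omega)).2, false_iff]; omega
        · simp only [hww', true_iff]; omega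
    · refine hmax _ (hc.reverse.extend hw (fun i _ => hcw _ (by omega)) fun i hi => ?_)
      constructor
      · intro h
        by_contra hid
        by_cases h2 : d - i = 1
        · exact h1 ⟨by omega, h2 ▸ h⟩
        · exact hfar (d - i) (by omega) (by omega) h
      · rintro rfl
        simpa using h0w

end

/-! ### The induction -/

section

variable {V : Type*} {G : SimpleGraph V} {X : Set V}

theorem cutConnected_univ_of_connected (hG : G.Connected) : CutConnected G Set.univ := by
  rintro S - ⟨a, ha⟩ ⟨b, -, hb⟩
  obtain ⟨p⟩ := hG.preconnected a b
  obtain ⟨e, -, h1, h2⟩ := p.exists_boundary_dart S ha hb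
  exact ⟨e.fst, h1, e.snd, ⟨trivial, h2⟩, e.adj⟩

theorem CutConnected.of_dominating {K : Set V} (hK : CutConnected G K) (hKX : K ⊆ X)
    (hdom : ∀ v ∈ X, v ∈ K ∨ ∃ x ∈ K, G.Adj x v) : CutConnected G X := by
  intro S hS ⟨s, hs⟩ ⟨t, ht, htS⟩
  by_cases h1 : (K ∩ S).Nonempty
  · by_cases h2 : (K \ S).Nonempty
    · obtain ⟨u, hu, v, hv, huv⟩ := hK (K ∩ S) Set.inter_subset_left h1
        (by rwa [Set.sdiff_self_inter])
      exact ⟨u, hu.2, v, ⟨hKX hv.1, fun h => hv.2 ⟨hv.1, h⟩⟩, huv⟩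
    · have hKS : K ⊆ S := fun z hz => by_contra fun h => h2 ⟨z, hz, h⟩
      obtain ⟨x, hx, hxt⟩ := (hdom t ht).resolve_left fun h => htS (hKS h)
      exact ⟨x, hKS hx, t, ⟨ht, htS⟩, hxt⟩
  · obtain ⟨x, hx, hxs⟩ := (hdom s (hS hs)).resolve_left fun h => h1 ⟨s, h, hs⟩
    exact ⟨s, hs, x, ⟨hKX hx, fun h => h1 ⟨x, hx, h⟩⟩, hxs.symm⟩

theorem cutConnected_of_isChain : ∀ l : List V, l.IsChain G.Adj → CutConnected G {v | v ∈ l}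
  | [], _ => fun S hS ⟨s, hs⟩ _ => by simpa using hS hs
  | [a], _ => by simpa using CutConnected.singleton a
  | a :: b :: l, h => by
    rw [List.isChain_cons_cons] at h
    have h1 := (cutConnected_of_isChain (b :: l) h.2).insert (a := a) (b := b) (by simp) h.1
    rwa [show insert a {v | v ∈ b :: l} = {v | v ∈ a :: b :: l} by ext; simp] at h1

theorem CutConnected.induce_univ (hX : CutConnected G X) :
    CutConnected (G.induce X) Set.univ := by
  rintro S - ⟨a, ha⟩ ⟨b, -, hb⟩
  obtain ⟨u, ⟨u, hu, rfl⟩, v, ⟨hv, hv'⟩, huv⟩ := hX (Subtype.val '' S) (by simp) ⟨a, a, ha, rfl⟩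
    ⟨b, b.2, fun ⟨b', hb', h⟩ => hb (Subtype.ext h ▸ hb')⟩
  exact ⟨u, hu, ⟨v, hv⟩, ⟨trivial, fun h => hv' ⟨_, h, rfl⟩⟩, huv⟩

theorem InducedFree.induce {W : Type*} {H : SimpleGraph W} (h : InducedFree H G) (X : Set V) :
    InducedFree H (G.induce X) :=
  fun hH => h (hH.trans ⟨SimpleGraph.Embedding.induce X⟩)

/-- If every vertex with two neighbours is a cut vertex, then `G` has a dominating path. -/
theorem exists_dominating_list_of_cut [Finite V] [Nonempty V] (hG : CutConnected G Set.univ)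
    (hcut : ∀ v a b, G.Adj v a → G.Adj v b → a ≠ b → ¬ CutConnected G (Set.univ \ {v}))
    (hS : InducedFree (subdividedClaw 2) G) (hT : InducedFree (subdividedNet 2) G) :
    ∃ l : List V, l ≠ [] ∧ l.Nodup ∧ l.IsChain G.Adj ∧ ∀ v, ∃ x ∈ l, v = x ∨ G.Adj x v := by
  let X : Set V := {v | ∃ a b, G.Adj v a ∧ G.Adj v b ∧ a ≠ b}
  have huniq : ∀ v ∉ X, ∀ a b, G.Adj v a → G.Adj v b → a = b := fun v hv a b ha hb =>
    by_contra fun h => hv ⟨a, b, ha, hb, h⟩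
  rcases X.eq_empty_or_nonempty with hX | ⟨x₀, hx₀⟩
  · rw [hX] at huniq
    obtain ⟨v₀⟩ := ‹Nonempty V›
    refine ⟨[v₀], by simp, by simp, by simp, fun w => ⟨v₀, by simp, ?_⟩⟩
    by_contra hw
    obtain ⟨s, hs, t, ⟨-, ht⟩, hst⟩ := hG {w | w = v₀ ∨ G.Adj v₀ w} (Set.subset_univ _)
      ⟨v₀, .inl rfl⟩ ⟨w, trivial, hw⟩
    rcases hs with rfl | hs
    · exact ht (.inr hst)
    · exact ht (.inl (huniq s (by simp) t v₀ hst hs.symm))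
  -- Add to `S` its neighbours outside `X`. These have no other neighbour, so an edge leaving the
  -- enlarged set starts in `S` and ends in `X`.
  have hconn : CutConnected G X := by
    intro S hSX ⟨s, hs⟩ ⟨t, ht, htS⟩
    obtain ⟨a, ha, b, ⟨-, hb⟩, hab⟩ := hG (S ∪ {w | w ∉ X ∧ ∃ s ∈ S, G.Adj s w})
      (Set.subset_univ _) ⟨s, .inl hs⟩ ⟨t, trivial, fun h => h.elim htS fun h => h.1 ht⟩
    rcases ha with ha | ⟨ha, s, hs, hsa⟩
    · by_cases hbX : b ∈ X
      · exact ⟨a, ha, b, ⟨hbX, fun h => hb (.inl h)⟩, hab⟩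
      · exact absurd (.inr ⟨hbX, a, ha, hab⟩) hb
    · exact absurd (.inl (huniq a ha s b hsa.symm hab ▸ hs)) hb
  obtain ⟨l, hne, hnd, hch, hmem⟩ := hconn.exists_hamiltonian_list_of_cut ⟨x₀, hx₀⟩ hG
    (fun v ⟨a, b, ha, hb, hab⟩ => hcut v a b ha hb hab) hS hT
  refine ⟨l, hne, hnd, hch, fun w => ?_⟩
  by_cases hw : w ∈ X
  · exact ⟨w, (hmem w).2 hw, .inl rfl⟩
  obtain ⟨m, -, hwm⟩ := hG.exists_adj (Set.mem_univ w) (Set.mem_univ x₀) fun h => hw (h ▸ hx₀)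
  refine ⟨m, (hmem m).2 ?_, .inr hwm.symm⟩
  -- Otherwise `w` and `m` would have only each other as neighbours, cutting them off from `x₀`.
  by_contra hm
  obtain ⟨s, hs, t, ⟨-, ht⟩, hst⟩ := hG {w, m} (Set.subset_univ _) ⟨w, .inl rfl⟩
    ⟨x₀, trivial, by rintro (rfl | rfl) <;> contradiction⟩
  rcases hs with rfl | rfl
  · exact ht (.inr (huniq s hw t m hst hwm))
  · exact ht (.inl (huniq s hm t w hst hwm.symm))

end

theorem exists_dominating_list {V : Type*} [Finite V] [Nonempty V] {G : SimpleGraph V}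
    (hG : CutConnected G Set.univ) (hS : InducedFree (subdividedClaw 2) G)
    (hT : InducedFree (subdividedNet 2) G) :
    ∃ l : List V, l ≠ [] ∧ l.Nodup ∧ l.IsChain G.Adj ∧ ∀ v, ∃ x ∈ l, v = x ∨ G.Adj x v := by
  induction hn : Nat.card V using Nat.strong_induction_on generalizing V with
  | _ n ih =>
  cases nonempty_fintype V
  have ihset : ∀ Y : Set V, Y.Nonempty → (∃ z, z ∉ Y) → CutConnected G Y →
      ∃ l : List V, l ≠ [] ∧ l.IsChain G.Adj ∧ l.Nodup ∧ (∀ v ∈ l, v ∈ Y) ∧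
        ∀ v ∈ Y, ∃ x ∈ l, v = x ∨ G.Adj x v := by
    rintro Y ⟨y, hy⟩ ⟨z, hz⟩ hY
    have : Nonempty Y := ⟨⟨y, hy⟩⟩
    have hlt : Nat.card Y < n := by
      rw [← hn, Nat.card_coe_set_eq, ← Set.ncard_univ]
      exact Set.ncard_lt_ncard ⟨Set.subset_univ _, fun h => hz (h trivial)⟩ (Set.toFinite _)
    obtain ⟨l, hne, hnd, hch, hdom⟩ := ih _ hlt hY.induce_univ (hS.induce Y) (hT.induce Y) rfl
    refine ⟨l.map Subtype.val, by rwa [ne_eq, List.map_eq_nil_iff], ?_,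
      hnd.map Subtype.val_injective, fun v hv => ?_, ?_⟩
    · rw [List.isChain_map]
      exact hch
    · obtain ⟨w, -, rfl⟩ := List.mem_map.1 hv
      exact w.2
    · intro v hv
      obtain ⟨x, hx, h⟩ := hdom ⟨v, hv⟩
      exact ⟨x, List.mem_map_of_mem hx, h.imp (congrArg Subtype.val) id⟩
  by_cases hcut : ∀ v a b, G.Adj v a → G.Adj v b → a ≠ b → ¬ CutConnected G (Set.univ \ {v})
  · exact exists_dominating_list_of_cut hG hcut hS hT
  push Not at hcut
  obtain ⟨v, u, b, hvu, hvb, hub, hconn⟩ := hcut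
  obtain ⟨l₀, hne₀, hch₀, hnd₀, hsub₀, hdom₀⟩ := ihset (Set.univ \ {v})
    ⟨u, trivial, hvu.ne'⟩
    ⟨v, fun h => h.2 rfl⟩ hconn
  by_cases hv₀ : ∃ x ∈ l₀, G.Adj x v
  · refine ⟨l₀, hne₀, hnd₀, hch₀, fun w => ?_⟩
    by_cases hwv : w = v
    · obtain ⟨x, hx, h⟩ := hv₀
      exact ⟨x, hx, .inr (hwv ▸ h)⟩
    · exact hdom₀ w ⟨trivial, hwv⟩
  -- The path `l₀` contains no neighbour of `v`, so it survives the deletion and dominates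
  -- everything that remains except possibly `v`, which hangs on `u`.
  have hYconn : CutConnected G (insert v {w | w ≠ v ∧ (w = u ∨ ¬ G.Adj v w)}) := by
    refine CutConnected.insert ?_ (b := u) ⟨hvu.ne', .inl rfl⟩ hvu
    refine (cutConnected_of_isChain l₀ hch₀).of_dominating ?_ ?_
    · exact fun w hw => ⟨(hsub₀ w hw).2, .inr fun h => hv₀ ⟨w, hw, h.symm⟩⟩
    · rintro w ⟨hw, -⟩
      obtain ⟨x, hx, h⟩ := hdom₀ w ⟨trivial, hw⟩
      rcases h with rfl | h
      · exact .inl hx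
      · exact .inr ⟨x, hx, h⟩
  obtain ⟨l, hne, hch, hnd, hsub, hdom⟩ :=
    ihset (insert v {w | w ≠ v ∧ (w = u ∨ ¬ G.Adj v w)}) ⟨v, .inl rfl⟩
    ⟨b, by rintro (h | ⟨-, h | h⟩); exacts [hvb.ne' h, hub h.symm, h hvb]⟩ hYconn
  by_cases hall : ∀ w, ∃ x ∈ l, w = x ∨ G.Adj x w
  · exact ⟨l, hne, hnd, hch, hall⟩
  push Not at hall
  obtain ⟨z, hz⟩ := hall
  have hzY : ∀ w, w ∉ insert v {w | w ≠ v ∧ (w = u ∨ ¬ G.Adj v w)} → G.Adj v w := fun w hw => by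
    by_contra h
    by_cases hwv : w = v
    · exact hw (.inl hwv)
    · exact hw (.inr ⟨hwv, .inr h⟩)
  have hzY' : z ∉ insert v {w | w ≠ v ∧ (w = u ∨ ¬ G.Adj v w)} := fun h => by
    obtain ⟨x, hx, h⟩ := hdom z h
    exact h.elim (hz x hx).1 (hz x hx).2
  have hvz : G.Adj v z := hzY z hzY'
  have hvl : v ∉ l := fun h => (hz v h).2 hvz
  have hlu : ∀ w ∈ l, G.Adj v w → w = u := fun w hw h =>
    ((hsub w hw).resolve_left fun h : w = v => hvl (h ▸ hw)).2.resolve_right fun h' => h' h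
  -- Within the reduced set `u` is the only neighbour of `v`, so it must be the vertex of `l` that
  -- dominates `v`.
  have hul : u ∈ l := by
    obtain ⟨x, hx, h⟩ := hdom v (.inl rfl)
    have hxv := h.resolve_left fun h => hvl (h ▸ hx)
    exact hlu x hx hxv.symm ▸ hx
  have hX : IsTailed G z v u (insert z (insert v {w | w ∈ l})) :=
    { conn := ((cutConnected_of_isChain l hch).insert hul hvu).insert (.inl rfl) hvz.symm
      dom := by
        intro w
        by_cases hw : w ∈ insert v {w | w ≠ v ∧ (w = u ∨ ¬ G.Adj v w)}
        · obtain ⟨x, hx, h⟩ := hdom w hw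
          exact ⟨x, .inr (.inr hx), h⟩
        · exact ⟨v, .inr (.inl rfl), .inr (hzY w hw)⟩
      mem₁ := .inl rfl
      mem₂ := .inr (.inl rfl)
      mem₃ := .inr (.inr hul)
      ne := fun h => (hz u hul).1 h
      adj₁₂ := hvz.symm
      adj₂₃ := hvu
      eq₁ := by
        rintro w (rfl | rfl | hw) h
        · exact absurd rfl h.ne
        · rfl
        · exact absurd h.symm (hz w hw).2
      eq₂ := by
        rintro w (rfl | rfl | hw) h
        · exact .inl rfl
        · exact absurd rfl h.ne
        · exact .inr (hlu w hw h) }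
  exact hX.exists_dominating_list hS hT

theorem hasDominatingPath_of_list {V : Type*} {G : SimpleGraph V}
    (h : ∃ l : List V, l ≠ [] ∧ l.Nodup ∧ l.IsChain G.Adj ∧ ∀ v, ∃ x ∈ l, v = x ∨ G.Adj x v) :
    HasDominatingPath G := by
  obtain ⟨l, hne, hnd, hch, hdom⟩ := h
  refine ⟨_, _, SimpleGraph.Walk.ofSupport l hne hch, ?_, fun w hw => ?_⟩
  · rw [SimpleGraph.Walk.isPath_def, SimpleGraph.Walk.support_ofSupport]
    exact hnd
  · rw [SimpleGraph.Walk.support_ofSupport] at hw ⊢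
    obtain ⟨x, hx, h⟩ := hdom w
    exact ⟨x, hx, (h.resolve_left fun h => hw (h ▸ hx)).symm⟩

theorem HasDominatingPath.pathEccentricity_le_one {V : Type*} {G : SimpleGraph V}
    (h : HasDominatingPath G) : pathEccentricity G ≤ 1 := by
  obtain ⟨u, v, p, hp, hdom⟩ := h
  refine (iInf_le_of_le u <| iInf_le_of_le v <| iInf_le_of_le p <| iInf_le _ hp).trans ?_
  refine iSup_le fun w => ?_
  by_cases hw : w ∈ p.support
  · exact iInf_le_of_le w (iInf_le_of_le hw (by simp))
  · obtain ⟨x, hx, hwx⟩ := hdom w hw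
    exact iInf_le_of_le x (iInf_le_of_le hx (SimpleGraph.edist_eq_one_iff_adj.2 hwx).le)

end PathEcc

theorem corollary4 {V : Type*} [Finite V] (G : SimpleGraph V) :
    (G.Connected → InducedFree (subdividedClaw 2) G → InducedFree (subdividedNet 2) G →
      HasDominatingPath G ∧ pathEccentricity G ≤ 1) ∧
    (InducedFree (SimpleGraph.pathGraph 5) G →
      InducedFree (subdividedClaw 2) G ∧ InducedFree (subdividedNet 2) G) ∧
    (ATFree G → InducedFree (subdividedClaw 2) G ∧ InducedFree (subdividedNet 2) G) ∧
    (Biconvex G → InducedFree (subdividedClaw 2) G ∧ InducedFree (subdividedNet 2) G) := by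
  refine ⟨fun hG hS hT => ?_, fun h => ?_, fun h => ?_, fun h => ?_⟩
  · have := hG.nonempty
    have hdom := hasDominatingPath_of_list
      (exists_dominating_list (cutConnected_univ_of_connected hG) hS hT)
    exact ⟨hdom, hdom.pathEccentricity_le_one⟩
  · exact ⟨h.of_isIndContained pathGraph_five_isIndContained_subdividedClaw,
      h.of_isIndContained pathGraph_five_isIndContained_subdividedNet⟩
  · exact ⟨h.inducedFree_subdividedClaw, h.inducedFree_subdividedNet⟩
  · exact ⟨h.inducedFree_subdividedClaw, h.inducedFree_subdividedNet⟩
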